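/- Let $L_n$ be the linear graph $1\leftrightarrow 2\leftrightarrow\cdots\leftrightarrow n$ on $[n]=\{1,\dots,n\}$, each unoriented edge being identified with the two oriented edges, and let $E_0$ be its set of oriented edges. An oriented edge $i\to j$ is rightward if $i<j$ and leftward if $i>j$; its length is $|i-j|$, the distance from $i$ to $j$ in $L_n$. Given $p_{\mathrm{left}}=p_{\mathrm{left}}(n)$ and $p_{\mathrm{right}}=p_{\mathrm{right}}(n)$ in $[0,1]$, let $E_{\mathrm{open}}$ be the random set that contains, independently, each leftward edge not in $E_0$ with probability $p_{\mathrm{left}}$ and each rightward edge not in $E_0$ with probability $p_{\mathrm{right}}$ (and no self-loops). Define the sets of occupied edges by $$E_{t+1}=E_t\cup\{\,i\to j\in E_{\mathrm{open}} : i\to k\in E_t \text{ and } k\to j\in E_t \text{ for some } k\in[n]\,\},\qquad t\ge 0,$$ and $E_\infty=\bigcup_{t\ge 0}E_t$. Events hold asymptotically almost surely (a.a.s.) if their probabilities tend to $1$ as $n\to\infty$. Fix $\alpha>0$. Then there are constants $c,C\in(0,\infty)$ and $A\in(0,1)$, depending only on $\alpha$, such that for all sequences $p_{\mathrm{left}}(n),p_{\mathrm{right}}(n)\in[0,1]$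 the following hold, where the stated inequalities between the densities and functions of $n$ are required for all sufficiently large $n$. 1. If $\max\{p_{\mathrm{left}},p_{\mathrm{right}}\}<c\,\frac{1}{\sqrt{\log n}}$, then a.a.s. $E_\infty$ contains no edge of length greater than $\alpha\log n$. 2. If $p_{\mathrm{left}}<c\,\frac{1}{\sqrt{\log n}}$ and $p_{\mathrm{right}}>A$, then a.a.s. $E_\infty$ contains every open rightward edge of length greater than $\alpha\log n$, but no leftward edge of length greater than $\alpha\log n$. 3. If $\min\{p_{\mathrm{left}},p_{\mathrm{right}}\}>C\,\frac{\log\log n}{\sqrt{\log n}}$, then a.a.s. saturation occurs: $E_\infty=E_0\cup E_{\mathrm{open}}$. -/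

import Mathlib

open MeasureTheory ProbabilityTheory Filter Topology

namespace TransClosure

/-- One step of the dynamics: an open edge `i → j` becomes occupied if `i → k` and `k → j` are
occupied for some vertex `k`. The edge `i → j` is the pair `(i, j)`. -/
def step {V : Type*} (Eopen E : Set (V × V)) : Set (V × V) :=
  E ∪ {e | e ∈ Eopen ∧ ∃ k : V, (e.1, k) ∈ E ∧ (k, e.2) ∈ E}

/-- The set `E_t` of edges occupied at time `t`. -/
def occupiedAt {V : Type*} (E0 Eopen : Set (V × V)) : ℕ → Set (V × V)
  | 0 => E0
  | t + 1 => step Eopen (occupiedAt E0 Eopen t)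

/-- The set `E_∞` of eventually occupied edges. -/
def eventuallyOccupied {V : Type*} (E0 Eopen : Set (V × V)) : Set (V × V) :=
  ⋃ t : ℕ, occupiedAt E0 Eopen t

/-- The edges of the unoriented linear graph `L_n`, each in both directions. -/
def lineEdges (n : ℕ) : Set (Fin n × Fin n) :=
  {e | (SimpleGraph.pathGraph n).Adj e.1 e.2}

/-- The length of `i → j`: the number of edges on a shortest path from `i` to `j` in `L_n`. -/
noncomputable def edgeLength {n : ℕ} (e : Fin n × Fin n) : ℕ :=
  (SimpleGraph.pathGraph n).dist e.1 e.2

def IsRightward {n : ℕ} (e : Fin n × Fin n) : Prop := e.1 < e.2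

def IsLeftward {n : ℕ} (e : Fin n × Fin n) : Prop := e.2 < e.1

/-- A configuration: one coin for every ordered pair of vertices. -/
abbrev Config (n : ℕ) : Type := Fin n × Fin n → Bool

/-- The open edges of a configuration. Initially occupied edges and self-loops are never open;
their coins are ignored. -/
def openEdges {n : ℕ} (ω : Config n) : Set (Fin n × Fin n) :=
  {e | e ∉ lineEdges n ∧ e.1 ≠ e.2 ∧ ω e = true}

/-- The probability that the coin of `e` shows `true`: `pright` for rightward edges and `pleft` for
leftward edges (the value for self-loops is irrelevant). -/
noncomputable def edgeProb {n : ℕ} (pleft pright : unitInterval) (e : Fin n × Fin n) :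
    unitInterval :=
  if e.1 < e.2 then pright else pleft

/-- The law of the configuration: independent coins with the above probabilities. -/
noncomputable def law (n : ℕ) (pleft pright : unitInterval) : Measure (Config n) :=
  Measure.pi fun e : Fin n × Fin n => bernoulliMeasure true false (edgeProb pleft pright e)

/-- `E_∞` for the configuration `ω` started from `L_n`. -/
def finalEdges {n : ℕ} (ω : Config n) : Set (Fin n × Fin n) :=
  eventuallyOccupied (lineEdges n) (openEdges ω)

/-- The events `Ev n` hold asymptotically almost surely under the laws with densities `pleft n`
and `pright n`. -/
def AAS (pleft pright : ℕ → unitInterval) (Ev : ∀ n : ℕ, Set (Config n)) : Prop :=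
  Tendsto (fun n : ℕ => law n (pleft n) (pright n) (Ev n)) atTop (𝓝 1)

end TransClosure

/-! Long edges at low density. Consider the first leftward edge of length more than X; its length is
at most 2X, because it joins two earlier edges. Unravel how it was built while following one gap (g,
g+1) underneath it. The piece covering the gap eventually shrinks to the unit edge. Just before
that, an open edge starts at g+1 and its companion from g is occupied (`LeftGood`), or the mirror
image holds for edges ending at g and g+1 (`RightGood`). Each event has probability at most p +
2Xp², which is small for X ≈ α log n and p ≤ c/√(log n). Over the even gaps the left events are
independent of each other, and so are the right events. Hence all X/2 even gaps below a given
interval are good with probability at most (2η)^(X/2), which beats the n choices of interval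
(`exists_good_gaps`, `integral_long_edge_le`). Reversing all edges gives the rightward case.

Rightward edges at high density. Scan from a fixed end and greedily merge filled intervals. The
intervals form a stack, and a stack of length at most one means that the whole interval is filled.
Whenever merging stops early, a specific fresh coin shows `false`, at cost q. An exponential moment
of the stack length and of the number of long stacks (`integral_stack_le`) shows that at least half
the stacks are long only with exponentially small probability. An open edge that stays unoccupied
has no interior vertex filled from both ends, so from one of its ends at least half the stacks are
long (`longCount_of_not_mem`).

Saturation. A saturated interval with end vertex u absorbs the neighbour w if, among the vertices
with an open edge to w, each reaches u along open edges, and likewise in reverse. Failure needs a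
directed cut, and averaging over the random neighbourhood bounds its probability by ℓ exp(-p²ℓ/4) up
to a constant (`integral_cutFail_le`). A fully open star with s ≈ log n / (4 log log n) leaves is a
saturated nucleus of probability at least p^(2s) ≥ n^(-1/4). At this size the remaining failure
probabilities sum to at most 1/2. Among about √n disjoint blocks of length about √n, one therefore
contains a nucleus that fills its block, and growth from that length on fails nowhere, with high
probability (`integral_not_saturated_le`). -/

namespace TransClosure

/-! ### Expectations over independent coins -/

section Coins

/-- The indicator of a proposition. -/
noncomputable def ind (P : Prop) : ℝ := open Classical in if P then 1 else 0

lemma ind_true {P : Prop} (h : P) : ind P = 1 := by simp [ind, h]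

lemma ind_false {P : Prop} (h : ¬ P) : ind P = 0 := by simp [ind, h]

lemma ind_nonneg (P : Prop) : 0 ≤ ind P := by unfold ind; split_ifs <;> norm_num

lemma ind_le_one (P : Prop) : ind P ≤ 1 := by unfold ind; split_ifs <;> norm_num

lemma ind_mono {P Q : Prop} (h : P → Q) : ind P ≤ ind Q := by
  by_cases hP : P
  · rw [ind_true hP, ind_true (h hP)]
  · rw [ind_false hP]; exact ind_nonneg Q

lemma ind_and (P Q : Prop) : ind (P ∧ Q) = ind P * ind Q := by
  by_cases hP : P <;> by_cases hQ : Q <;> simp [ind, hP, hQ]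

lemma ind_not (P : Prop) : ind (¬ P) = 1 - ind P := by
  by_cases hP : P <;> simp [ind, hP]

lemma ind_or_le (P Q : Prop) : ind (P ∨ Q) ≤ ind P + ind Q := by
  by_cases hP : P <;> by_cases hQ : Q <;> simp [ind, hP, hQ]

lemma ind_exists_le_sum {κ : Type*} (s : Finset κ) (P : κ → Prop) :
    ind (∃ i ∈ s, P i) ≤ ∑ i ∈ s, ind (P i) := by
  by_cases h : ∃ i ∈ s, P i
  · obtain ⟨i, hi, hP⟩ := h
    rw [ind_true ⟨i, hi, hP⟩, ← ind_true hP]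
    exact Finset.single_le_sum (f := fun i => ind (P i)) (fun i _ => ind_nonneg _) hi
  · rw [ind_false h]; exact Finset.sum_nonneg fun i _ => ind_nonneg _

lemma ind_forall {κ : Type*} (s : Finset κ) (P : κ → Prop) :
    ind (∀ i ∈ s, P i) = ∏ i ∈ s, ind (P i) := by
  by_cases h : ∀ i ∈ s, P i
  · rw [ind_true h, Finset.prod_congr rfl fun i hi => ind_true (h i hi), Finset.prod_const_one]
  · rw [ind_false h]
    push Not at h
    obtain ⟨i, hi, hP⟩ := h
    exact (Finset.prod_eq_zero hi (ind_false hP)).symm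

variable {ι : Type*} [Fintype ι]

/-- The law of independent coins, the `i`-th of which shows `true` with probability `r i`. -/
noncomputable def coinLaw (r : ι → unitInterval) : Measure (ι → Bool) :=
  Measure.pi fun i => bernoulliMeasure true false (r i)

instance (r : ι → unitInterval) : IsProbabilityMeasure (coinLaw r) := by
  unfold coinLaw; infer_instance

variable (r : ι → unitInterval)

lemma integral_mono_coins {f g : (ι → Bool) → ℝ} (h : ∀ ω, f ω ≤ g ω) :
    ∫ ω, f ω ∂coinLaw r ≤ ∫ ω, g ω ∂coinLaw r :=
  integral_mono .of_finite .of_finite h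

lemma real_eq_integral_ind (s : Set (ι → Bool)) :
    (coinLaw r).real s = ∫ ω, ind (ω ∈ s) ∂coinLaw r := by
  have : (fun ω => ind (ω ∈ s)) = s.indicator 1 := by
    funext ω
    by_cases h : ω ∈ s <;> simp [ind, h]
  rw [this, integral_indicator_one (Set.toFinite s).measurableSet]

lemma integral_coin (i : ι) (h : Bool → ℝ) :
    ∫ ω, h (ω i) ∂coinLaw r = r i * h true + (1 - r i) * h false := by
  have hmap : (coinLaw r).map (fun ω => ω i) = bernoulliMeasure true false (r i) :=
    (measurePreserving_eval (fun i => bernoulliMeasure true false (r i)) i).map_eq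
  rw [← integral_map (φ := fun ω : ι → Bool => ω i) (f := h)
    (measurable_pi_apply i).aemeasurable (by fun_prop), hmap, bernoulliMeasure_def, integral_add_measure .of_finite .of_finite,
    integral_smul_nnreal_measure, integral_smul_nnreal_measure]
  simp [NNReal.smul_def]

lemma integral_ind_true (i : ι) : ∫ ω, ind (ω i = true) ∂coinLaw r = r i := by
  rw [integral_coin r i fun b => ind (b = true)]; simp [ind]

lemma integral_ind_false (i : ι) : ∫ ω, ind (ω i = false) ∂coinLaw r = 1 - r i := by
  rw [integral_coin r i fun b => ind (b = false)]; simp [ind]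

/-- Functions of disjoint sets of coins are independent. -/
lemma integral_mul_of_dependsOn {f g : (ι → Bool) → ℝ} {s t : Set ι} (hst : Disjoint s t)
    (hf : DependsOn f s) (hg : DependsOn g t) :
    ∫ ω, f ω * g ω ∂coinLaw r = (∫ ω, f ω ∂coinLaw r) * ∫ ω, g ω ∂coinLaw r := by
  classical
  have hi : iIndepFun (fun (i : ι) (ω : ι → Bool) => ω i) (coinLaw r) :=
    iIndepFun_pi (X := fun (_ : ι) (b : Bool) => b) (fun _ => by fun_prop)
  have h2 := hi.indepFun_finset s.toFinite.toFinset t.toFinite.toFinset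
    (by simpa [Set.Finite.disjoint_toFinset] using hst) (fun i => by fun_prop)
  have key : ∀ {h : (ι → Bool) → ℝ} {u : Set ι}, DependsOn h u →
      ∃ H : ((i : u.toFinite.toFinset) → Bool) → ℝ, ∀ ω, h ω = H fun i => ω i := by
    intro h u hu
    -- The value `false` outside `u` is arbitrary, since `h` does not read those coins.
    refine ⟨fun x => h fun i => if hi : i ∈ u.toFinite.toFinset then x ⟨i, hi⟩ else false,
      fun ω => hu fun i hi => ?_⟩
    have : i ∈ u.toFinite.toFinset := by simpa using hi
    simp only [this, dite_true]
  obtain ⟨F, hF⟩ := key hf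
  obtain ⟨G, hG⟩ := key hg
  simp only [hF, hG]
  exact h2.integral_fun_comp_mul_comp (measurable_of_finite _).aemeasurable
    (measurable_of_finite _).aemeasurable
    (measurable_of_finite _).aestronglyMeasurable (measurable_of_finite _).aestronglyMeasurable

lemma integral_prod_of_dependsOn {κ : Type*} (T : Finset κ) (f : κ → (ι → Bool) → ℝ)
    (s : κ → Set ι) (hs : ∀ i ∈ T, ∀ j ∈ T, i ≠ j → Disjoint (s i) (s j))
    (hf : ∀ i ∈ T, DependsOn (f i) (s i)) :
    ∫ ω, ∏ i ∈ T, f i ω ∂coinLaw r = ∏ i ∈ T, ∫ ω, f i ω ∂coinLaw r := by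
  classical
  induction T using Finset.induction_on with
  | empty => simp
  | insert a T ha ih =>
    simp only [Finset.prod_insert ha]
    rw [integral_mul_of_dependsOn r (s := s a) (t := ⋃ i ∈ T, s i), ih]
    · exact fun i hi j hj => hs i (Finset.mem_insert_of_mem hi) j (Finset.mem_insert_of_mem hj)
    · exact fun i hi => hf i (Finset.mem_insert_of_mem hi)
    · simp only [Set.disjoint_iUnion_right]
      exact fun i hi => hs a (Finset.mem_insert_self _ _) i (Finset.mem_insert_of_mem hi)
        fun h => ha (h ▸ hi)
    · exact hf a (Finset.mem_insert_self _ _)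
    · intro ω ω' h
      refine Finset.prod_congr rfl fun i hi => hf i (Finset.mem_insert_of_mem hi) fun e he => ?_
      exact h e (Set.mem_biUnion hi he)

lemma integral_forall_le_pow {κ : Type*} (H : Finset κ) {P : κ → (ι → Bool) → Prop}
    {s : κ → Set ι} {δ : ℝ} (hs : ∀ i ∈ H, ∀ j ∈ H, i ≠ j → Disjoint (s i) (s j))
    (hP : ∀ h ∈ H, DependsOn (fun ω => ind (P h ω)) (s h))
    (hδ : ∀ h ∈ H, ∫ ω, ind (P h ω) ∂coinLaw r ≤ δ) :
    ∫ ω, ind (∀ h ∈ H, P h ω) ∂coinLaw r ≤ δ ^ H.card := by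
  simp only [ind_forall]
  rw [integral_prod_of_dependsOn r H (fun h ω => ind (P h ω)) s hs hP]
  calc _ ≤ ∏ _h ∈ H, δ :=
        Finset.prod_le_prod (fun h _ => integral_nonneg fun _ => ind_nonneg _) hδ
    _ = δ ^ H.card := Finset.prod_const δ

lemma integral_prod_coins (T : Finset ι) (h : ι → Bool → ℝ) :
    ∫ ω, ∏ i ∈ T, h i (ω i) ∂coinLaw r = ∏ i ∈ T, (r i * h i true + (1 - r i) * h i false) := by
  rw [integral_prod_of_dependsOn r T (fun i ω => h i (ω i)) (fun i => {i})
    (fun i _ j _ hij => by simpa using hij) (fun i _ ω ω' hω => by simp only [hω i rfl])]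
  exact Finset.prod_congr rfl fun i _ => integral_coin r i (h i)

/-- Conditioning on the coins of `T` showing `true` amounts to biasing them completely. -/
lemma integral_ind_forall_mul [DecidableEq ι] (T : Finset ι) (f : (ι → Bool) → ℝ) :
    ∫ ω, ind (∀ i ∈ T, ω i = true) * f ω ∂coinLaw r =
      (∏ i ∈ T, (r i : ℝ)) * ∫ ω, f ω ∂coinLaw (fun i => if i ∈ T then 1 else r i) := by
  -- On the event, the coins of `T` can be overwritten by `true` inside `f`. The two factors then
  -- read disjoint sets of coins, and overwriting pushes the law forward to the one with bias 1 on
  -- `T`.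
  have h1 : ∀ ω : ι → Bool, ind (∀ i ∈ T, ω i = true) * f ω =
      ind (∀ i ∈ T, ω i = true) * f (fun i => if i ∈ T then true else ω i) := by
    intro ω
    by_cases h : ∀ i ∈ T, ω i = true
    · congr 2
      funext i
      split_ifs with hi
      · exact h i hi
      · rfl
    · simp [ind_false h]
  simp only [h1]
  rw [integral_mul_of_dependsOn r (s := (T : Set ι)) (t := (T : Set ι)ᶜ) disjoint_compl_right]
  · congr 1
    · simp only [ind_forall]
      rw [integral_prod_coins r T fun _ b => ind (b = true)]
      simp [ind]
    · have hmap : coinLaw (fun i => if i ∈ T then 1 else r i) =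
          (coinLaw r).map (fun ω i => if i ∈ T then true else ω i) := by
        unfold coinLaw
        have := Measure.pi_map_pi (μ := fun i => bernoulliMeasure true false (r i))
          (f := fun i b => if i ∈ T then true else b)
          (hf := fun i => (measurable_of_finite _).aemeasurable)
        rw [this]
        congr 1
        funext i
        by_cases hi : i ∈ T
        · simp [hi]
        · simp [hi]
      rw [hmap, integral_map (measurable_of_finite _).aemeasurable
        (measurable_of_finite _).aestronglyMeasurable]
  · intro ω ω' h
    refine congrArg ind (propext ⟨fun H i hi => ?_, fun H i hi => ?_⟩)
    · rw [← h i hi, H i hi]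
    · rw [h i hi, H i hi]
  · intro ω ω' h
    refine congrArg f (funext fun i => ?_)
    split_ifs with hi
    · rfl
    · exact h i hi

end Coins

lemma AAS_of_compl_le {pleft pright : ℕ → unitInterval} {Ev : ∀ n : ℕ, Set (Config n)}
    {u : ℕ → ℝ} (hu : Tendsto u atTop (𝓝 0))
    (h : ∀ᶠ n in atTop,
      ∫ ω, ind (ω ∉ Ev n) ∂coinLaw (edgeProb (n := n) (pleft n) (pright n)) ≤ u n) :
    AAS pleft pright Ev := by
  have hreal : Tendsto (fun n => (coinLaw (edgeProb (n := n) (pleft n) (pright n))).real (Ev n))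
      atTop (𝓝 1) := by
    have h1 : Tendsto (fun n => 1 - u n) atTop (𝓝 1) := by simpa using hu.const_sub 1
    refine tendsto_of_tendsto_of_tendsto_of_le_of_le' h1 tendsto_const_nhds ?_
      (Eventually.of_forall fun n => measureReal_le_one)
    filter_upwards [h] with n hn
    have h2 : ∫ ω, ind (ω ∉ Ev n) ∂coinLaw (edgeProb (n := n) (pleft n) (pright n)) =
        1 - ∫ ω, ind (ω ∈ Ev n) ∂coinLaw (edgeProb (n := n) (pleft n) (pright n)) := by
      simp only [ind_not]
      rw [integral_sub .of_finite .of_finite]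
      simp
    rw [real_eq_integral_ind]
    linarith
  have h3 := ENNReal.tendsto_ofReal hreal
  rw [ENNReal.ofReal_one] at h3
  exact h3.congr fun n => ofReal_measureReal
    (μ := coinLaw (edgeProb (n := n) (pleft n) (pright n))) (measure_ne_top _ _)

/-! ### The dynamics -/

section Dynamics

variable {V : Type*} {E0 Eo : Set (V × V)}

lemma occupiedAt_mono : Monotone (occupiedAt E0 Eo) :=
  monotone_nat_of_le_succ fun _ => Set.subset_union_left

lemma occupiedAt_subset (t : ℕ) : occupiedAt E0 Eo t ⊆ E0 ∪ Eo := by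
  induction t with
  | zero => exact Set.subset_union_left
  | succ t ih =>
    rintro e (he | he)
    · exact ih he
    · exact Or.inr he.1

lemma eventuallyOccupied_subset : eventuallyOccupied E0 Eo ⊆ E0 ∪ Eo :=
  Set.iUnion_subset occupiedAt_subset

lemma subset_eventuallyOccupied : E0 ⊆ eventuallyOccupied E0 Eo :=
  Set.subset_iUnion (occupiedAt E0 Eo) 0

lemma eventuallyOccupied_join {x k y : V} (h : (x, y) ∈ E0 ∪ Eo)
    (h1 : (x, k) ∈ eventuallyOccupied E0 Eo) (h2 : (k, y) ∈ eventuallyOccupied E0 Eo) :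
    (x, y) ∈ eventuallyOccupied E0 Eo := by
  rcases h with h | h
  · exact subset_eventuallyOccupied h
  obtain ⟨s, hs⟩ := Set.mem_iUnion.1 h1
  obtain ⟨t, ht⟩ := Set.mem_iUnion.1 h2
  refine Set.mem_iUnion.2 ⟨max s t + 1, Or.inr ⟨h, k, ?_, ?_⟩⟩
  · exact occupiedAt_mono (le_max_left s t) hs
  · exact occupiedAt_mono (le_max_right s t) ht

/-- The triangle rule is symmetric under reversing all edges. Statements about rightward edges
thereby reduce to statements about leftward ones. -/
lemma occupiedAt_swap (t : ℕ) :
    occupiedAt (Prod.swap ⁻¹' E0) (Prod.swap ⁻¹' Eo) t = Prod.swap ⁻¹' occupiedAt E0 Eo t := by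
  induction t with
  | zero => rfl
  | succ t ih =>
    ext ⟨x, y⟩
    simp only [occupiedAt, step, ih, Set.mem_union, Set.mem_preimage, Set.mem_ofPred_eq,
      Prod.swap_prod_mk]
    refine or_congr Iff.rfl (and_congr Iff.rfl ?_)
    exact exists_congr fun k => and_comm

lemma eventuallyOccupied_swap :
    eventuallyOccupied (Prod.swap ⁻¹' E0) (Prod.swap ⁻¹' Eo) =
      Prod.swap ⁻¹' eventuallyOccupied E0 Eo := by
  simp only [eventuallyOccupied, occupiedAt_swap, Set.preimage_iUnion]

end Dynamics

/-! ### The linear graph, and the gaps under a leftward edge -/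

section Line

variable {n : ℕ}

lemma mem_lineEdges {e : Fin n × Fin n} :
    e ∈ lineEdges n ↔ e.1.val + 1 = e.2.val ∨ e.2.val + 1 = e.1.val :=
  SimpleGraph.pathGraph_adj

lemma swap_preimage_lineEdges : Prod.swap ⁻¹' lineEdges n = lineEdges n := by
  ext e
  simp only [Set.mem_preimage, mem_lineEdges, Prod.fst_swap, Prod.snd_swap]
  exact or_comm

lemma mem_line_or_open {ω : Config n} {x y : Fin n} (hxy : x ≠ y) (h : ω (x, y) = true) :
    (x, y) ∈ lineEdges n ∪ openEdges ω := by
  by_cases hl : (x, y) ∈ lineEdges n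
  · exact Or.inl hl
  · exact Or.inr ⟨hl, hxy, h⟩

lemma walk_length_ge {x y : Fin n} (w : (SimpleGraph.pathGraph n).Walk x y) :
    x.val ≤ y.val + w.length ∧ y.val ≤ x.val + w.length := by
  induction w with
  | nil => simp
  | cons h _ ih =>
    have := SimpleGraph.pathGraph_adj.1 h
    simp only [SimpleGraph.Walk.length_cons]
    omega

lemma exists_walk_length (d : ℕ) : ∀ x y : Fin n, x.val + d = y.val →
    ∃ w : (SimpleGraph.pathGraph n).Walk x y, w.length = d := by
  induction d with
  | zero =>
    intro x y h
    obtain rfl : x = y := Fin.ext h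
    exact ⟨.nil, rfl⟩
  | succ d ih =>
    intro x y h
    obtain ⟨w, hw⟩ := ih ⟨x.val + 1, by omega⟩ y (by simp only; omega)
    exact ⟨.cons (SimpleGraph.pathGraph_adj.2 (Or.inl rfl)) w, by simp [hw]⟩

lemma edgeLength_of_le {x y : Fin n} (h : x ≤ y) : edgeLength (x, y) = y.val - x.val := by
  have h' : x.val ≤ y.val := h
  obtain ⟨w, hw⟩ := exists_walk_length (y.val - x.val) x y (by omega)
  refine le_antisymm (hw ▸ SimpleGraph.dist_le w) ?_
  obtain ⟨v, hv⟩ := (SimpleGraph.pathGraph_preconnected n x y).exists_walk_length_eq_dist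
  have := walk_length_ge v
  simp only [edgeLength]
  omega

lemma edgeLength_swap (e : Fin n × Fin n) : edgeLength e.swap = edgeLength e :=
  SimpleGraph.dist_comm

/-- Some vertex to the left of the gap `g, g + 1` receives edges of `C` from both sides of it. -/
def LeftGood (C : Set (Fin n × Fin n)) (M g : ℕ) : Prop :=
  ∃ j k l : Fin n, k.val = g ∧ l.val = g + 1 ∧ j.val < g ∧ g + 1 ≤ j.val + M ∧ (l, j) ∈ C ∧
    ((k, j) ∈ C ∨ j.val + 1 = g)

/-- Some vertex to the right of the gap `g, g + 1` sends edges of `C` to both sides of it. -/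
def RightGood (C : Set (Fin n × Fin n)) (M g : ℕ) : Prop :=
  ∃ i k l : Fin n, k.val = g ∧ l.val = g + 1 ∧ g + 1 < i.val ∧ i.val ≤ g + M ∧ (i, k) ∈ C ∧
    ((i, l) ∈ C ∨ i.val = g + 2)

variable {Eo : Set (Fin n × Fin n)}

/-- A leftward edge of length at least two can only be occupied over good gaps. -/
lemma good_of_occupiedAt {M : ℕ} (hne : ∀ e ∈ Eo, e.1 ≠ e.2) (t : ℕ)
    (hM : ∀ e ∈ occupiedAt (lineEdges n) Eo t, e.1.val ≤ e.2.val + M)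
    {x y : Fin n} (he : (x, y) ∈ occupiedAt (lineEdges n) Eo t) {g : ℕ} (hy : y.val ≤ g)
    (hx : g + 1 ≤ x.val) (hlen : y.val + 2 ≤ x.val) : LeftGood Eo M g ∨ RightGood Eo M g := by
  induction t generalizing x y with
  | zero =>
    have := mem_lineEdges.1 he
    simp only at this
    omega
  | succ t ih =>
    have hM' : ∀ e ∈ occupiedAt (lineEdges n) Eo t, e.1.val ≤ e.2.val + M :=
      fun e he => hM e (Or.inl he)
    rcases id he with he' | ⟨ho, k, h1, h2⟩
    · exact ih hM' he' hy hx hlen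
    simp only at h1 h2
    have hd : ∀ {u v : Fin n}, (u, v) ∈ occupiedAt (lineEdges n) Eo t →
        (u.val + 1 = v.val ∨ v.val + 1 = u.val) ∨ (u, v) ∈ Eo ∧ u.val ≠ v.val := by
      intro u v huv
      rcases occupiedAt_subset t huv with h | h
      · exact Or.inl (mem_lineEdges.1 h)
      · exact Or.inr ⟨h, fun h' => hne _ h (Fin.ext h')⟩
    have hMe := hM _ he
    simp only at hMe
    have d1 := hd h1
    have d2 := hd h2
    -- If `k` lies outside the interval from `y` to `x`, one of the two pieces still covers the gap.
    -- If it lies inside, exactly one piece does. The induction stops when that piece is the unit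
    -- edge, and the edge `x → y` is then the open edge required for a good gap.
    rcases lt_or_ge x.val k.val with hk | hk
    · exact ih hM' h2 hy (by omega) (by omega)
    rcases lt_or_ge k.val y.val with hk' | hk'
    · exact ih hM' h1 (by omega) hx (by omega)
    rcases le_or_gt k.val g with hg | hg
    · by_cases h : k.val + 2 ≤ x.val
      · exact ih hM' h1 hg hx h
      · refine Or.inl ⟨y, k, x, by omega, by omega, by omega, by omega, ho, ?_⟩
        rcases d2 with d2 | d2
        · exact Or.inr (by omega)
        · exact Or.inl d2.1
    · by_cases h : y.val + 2 ≤ k.val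
      · exact ih hM' h2 hy (by omega) h
      · refine Or.inr ⟨x, y, k, by omega, by omega, by omega, by omega, ho, ?_⟩
        rcases d1 with d1 | d1
        · exact Or.inr (by omega)
        · exact Or.inl d1.1

/-- At the first time that a leftward edge longer than `X` exists, every leftward edge is either old
or a join of two edges with leftward displacement at most `X`. This is where the cutoff `2 * X`
comes from. -/
lemma exists_good_gaps {X : ℕ} (hX : 1 ≤ X) (hne : ∀ e ∈ Eo, e.1 ≠ e.2)
    {e : Fin n × Fin n} (he : e ∈ eventuallyOccupied (lineEdges n) Eo)
    (hlen : e.2.val + X < e.1.val) :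
    ∃ a, a + X + 1 < n ∧ ∀ g, a ≤ g → g ≤ a + X → LeftGood Eo (2 * X) g ∨
      RightGood Eo (2 * X) g := by
  classical
  have hex : ∃ t, ∃ e ∈ occupiedAt (lineEdges n) Eo t, e.2.val + X < e.1.val := by
    obtain ⟨t, ht⟩ := Set.mem_iUnion.1 he
    exact ⟨t, e, ht, hlen⟩
  obtain ⟨⟨x, y⟩, hxy, hl⟩ := Nat.find_spec hex
  have hmin := fun s (hs : s < Nat.find hex) => Nat.find_min hex hs
  set t := Nat.find hex
  simp only at hl
  refine ⟨y.val, by omega, fun g h1 h2 => good_of_occupiedAt hne t ?_ hxy h1 (by omega) (by omega)⟩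
  intro e he
  rcases ht : t with _ | s
  · rw [ht] at he
    have := mem_lineEdges.1 he
    omega
  have hs : ∀ e ∈ occupiedAt (lineEdges n) Eo s, e.1.val ≤ e.2.val + X := by
    intro e he
    by_contra h
    exact hmin s (by omega) ⟨e, he, by omega⟩
  rw [ht] at he
  rcases he with he | ⟨-, k, h1, h2⟩
  · have := hs e he
    omega
  · have := hs _ h1
    have := hs _ h2
    simp only at *
    omega

end Line

/-! ### Absence of long edges -/

section Gaps

variable {n : ℕ}

lemma LeftGood.mono {C D : Set (Fin n × Fin n)} (h : C ⊆ D) {M g : ℕ} :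
    LeftGood C M g → LeftGood D M g := by
  rintro ⟨j, k, l, h1, h2, h3, h4, h5, h6⟩
  exact ⟨j, k, l, h1, h2, h3, h4, h h5, h6.imp_left (@h _)⟩

lemma RightGood.mono {C D : Set (Fin n × Fin n)} (h : C ⊆ D) {M g : ℕ} :
    RightGood C M g → RightGood D M g := by
  rintro ⟨j, k, l, h1, h2, h3, h4, h5, h6⟩
  exact ⟨j, k, l, h1, h2, h3, h4, h h5, h6.imp_left (@h _)⟩

variable (r : Fin n × Fin n → unitInterval) {σ : Fin n × Fin n → Fin n × Fin n} {p : ℝ}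

/-- The edges whose coins, read through `σ`, show `true`. -/
def coinEdges (σ : Fin n × Fin n → Fin n × Fin n) (ω : Config n) : Set (Fin n × Fin n) :=
  {e | ω (σ e) = true}

lemma integral_two_coins_le
    (hσ : Function.Injective σ)
    {a b : Fin n × Fin n} (hab : a ≠ b) (hp : 0 ≤ p)
    (ha : (r (σ a) : ℝ) ≤ p) (hb : (r (σ b) : ℝ) ≤ p) :
    ∫ ω, ind (ω (σ a) = true ∧ ω (σ b) = true) ∂coinLaw r ≤ p ^ 2 := by
  simp only [ind_and]
  rw [integral_mul_of_dependsOn r (s := {σ a}) (t := {σ b}) (by simpa using hσ.ne hab)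
    (fun ω ω' h => by simp only [h _ rfl]) (fun ω ω' h => by simp only [h _ rfl]),
    integral_ind_true, integral_ind_true, sq]
  exact mul_le_mul ha hb (r _).2.1 hp

lemma card_filter_val_le (a b : ℕ) :
    (Finset.univ.filter fun j : Fin n => a ≤ j.val ∧ j.val < b).card ≤ b - a := by
  rw [← Nat.card_Ico]
  refine Finset.card_le_card_of_injOn Fin.val (fun j hj => ?_) (Fin.val_injective.injOn)
  simpa using hj

/-- Union bound for one distinguished coin or one of at most `M` pairs of distinct coins. The
distinguished coin is the edge of length two, whose companion is an initially occupied unit edge and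
costs nothing. -/
lemma integral_pairs_le
    (hσ : Function.Injective σ)
    {P : Config n → Prop} {J : Finset (Fin n)} {a b : Fin n → Fin n × Fin n}
    {x : Fin n × Fin n} {M : ℕ} (hP : ∀ ω, P ω → ω (σ x) = true ∨
      ∃ j ∈ J, ω (σ (a j)) = true ∧ ω (σ (b j)) = true) (hp : 0 ≤ p) (hJ : J.card ≤ M)
    (hx : (r (σ x) : ℝ) ≤ p) (hab : ∀ j ∈ J, a j ≠ b j) (ha : ∀ j ∈ J, (r (σ (a j)) : ℝ) ≤ p)
    (hb : ∀ j ∈ J, (r (σ (b j)) : ℝ) ≤ p) : ∫ ω, ind (P ω) ∂coinLaw r ≤ p + M * p ^ 2 := by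
  calc ∫ ω, ind (P ω) ∂coinLaw r
      ≤ ∫ ω, (ind (ω (σ x) = true) +
          ∑ j ∈ J, ind (ω (σ (a j)) = true ∧ ω (σ (b j)) = true)) ∂coinLaw r := by
        refine integral_mono_coins r fun ω => (ind_mono (hP ω)).trans ((ind_or_le _ _).trans ?_)
        gcongr
        exact ind_exists_le_sum _ _
    _ ≤ p + ∑ j ∈ J, p ^ 2 := by
        rw [integral_add .of_finite .of_finite, integral_finsetSum _ fun _ _ => .of_finite,
          integral_ind_true]
        exact add_le_add hx (Finset.sum_le_sum fun j hj =>
          integral_two_coins_le r hσ (hab j hj) hp (ha j hj) (hb j hj))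
    _ ≤ p + M * p ^ 2 := by
        rw [Finset.sum_const, nsmul_eq_mul]
        gcongr

lemma integral_leftGood_le
    (hσ : Function.Injective σ)
    (hr : ∀ e : Fin n × Fin n, e.2 < e.1 → (r (σ e) : ℝ) ≤ p)
    (hp : 0 ≤ p) (M g : ℕ) :
    ∫ ω, ind (LeftGood (coinEdges σ ω) M g) ∂coinLaw r ≤ p + M * p ^ 2 := by
  by_cases hg : g + 1 < n ∧ 1 ≤ g
  · have h0 : g - 1 < n := by omega
    have h1 : g < n := by omega
    refine integral_pairs_le r hσ (x := (⟨g + 1, hg.1⟩, ⟨g - 1, h0⟩))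
      (J := Finset.univ.filter fun j : Fin n => g + 1 - M ≤ j.val ∧ j.val < g)
      (a := fun j => (⟨g + 1, hg.1⟩, j)) (b := fun j => (⟨g, h1⟩, j)) ?_ hp
      ((card_filter_val_le _ _).trans (by omega)) (hr _ ?_) ?_ ?_ ?_
    · rintro ω ⟨j, k, l, hk, hl, hjg, hM, hlj, hkj⟩
      obtain rfl : k = ⟨g, h1⟩ := Fin.ext hk
      obtain rfl : l = ⟨g + 1, hg.1⟩ := Fin.ext hl
      rcases hkj with hkj | hkj
      · refine Or.inr ⟨j, ?_, hlj, hkj⟩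
        simp only [Finset.mem_filter, Finset.mem_univ, true_and]
        omega
      · obtain rfl : j = ⟨g - 1, h0⟩ := Fin.ext (by simp only; omega)
        exact Or.inl hlj
    · simp only [Fin.mk_lt_mk]; omega
    · intro j _ h
      simp at h
    · intro j hj
      simp only [Finset.mem_filter, Finset.mem_univ, true_and] at hj
      exact hr _ (by simp only [Fin.lt_def]; omega)
    · intro j hj
      simp only [Finset.mem_filter, Finset.mem_univ, true_and] at hj
      exact hr _ (by simp only [Fin.lt_def]; omega)
  · have : ∀ ω, ind (LeftGood (coinEdges σ ω) M g) = 0 := fun ω => ind_false <| by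
      rintro ⟨j, k, l, hk, hl, hjg, -⟩
      omega
    simp only [this, integral_zero]
    positivity

lemma integral_rightGood_le
    (hσ : Function.Injective σ)
    (hr : ∀ e : Fin n × Fin n, e.2 < e.1 → (r (σ e) : ℝ) ≤ p)
    (hp : 0 ≤ p) (M g : ℕ) :
    ∫ ω, ind (RightGood (coinEdges σ ω) M g) ∂coinLaw r ≤ p + M * p ^ 2 := by
  by_cases hg : g + 2 < n
  · have h0 : g + 1 < n := by omega
    have h1 : g < n := by omega
    refine integral_pairs_le r hσ (x := (⟨g + 2, hg⟩, ⟨g, h1⟩))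
      (J := Finset.univ.filter fun j : Fin n => g + 2 ≤ j.val ∧ j.val < g + M + 1)
      (a := fun j => (j, ⟨g, h1⟩)) (b := fun j => (j, ⟨g + 1, h0⟩)) ?_ hp
      ((card_filter_val_le _ _).trans (by omega)) (hr _ ?_) ?_ ?_ ?_
    · rintro ω ⟨j, k, l, hk, hl, hjg, hM, hlj, hkj⟩
      obtain rfl : k = ⟨g, h1⟩ := Fin.ext hk
      obtain rfl : l = ⟨g + 1, h0⟩ := Fin.ext hl
      rcases hkj with hkj | hkj
      · refine Or.inr ⟨j, ?_, hlj, hkj⟩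
        simp only [Finset.mem_filter, Finset.mem_univ, true_and]
        omega
      · obtain rfl : j = ⟨g + 2, hg⟩ := Fin.ext (by simp only; omega)
        exact Or.inl hlj
    · simp only [Fin.mk_lt_mk]; omega
    · intro j _ h
      simp at h
    · intro j hj
      simp only [Finset.mem_filter, Finset.mem_univ, true_and] at hj
      exact hr _ (by simp only [Fin.lt_def]; omega)
    · intro j hj
      simp only [Finset.mem_filter, Finset.mem_univ, true_and] at hj
      exact hr _ (by simp only [Fin.lt_def]; omega)
  · have : ∀ ω, ind (RightGood (coinEdges σ ω) M g) = 0 := fun ω => ind_false <| by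
      rintro ⟨j, k, l, hk, hl, hjg, -⟩
      omega
    simp only [this, integral_zero]
    positivity

/-- Only edges starting at `g` or `g + 1` matter here, and only edges ending there in the right-hand
version. Gaps starting at distinct even vertices thus use disjoint coins within each version,
whereas a left event and a right event may share a coin. -/
lemma dependsOn_leftGood (M g : ℕ) :
    DependsOn (fun ω => ind (LeftGood (coinEdges σ ω) M g))
      (σ '' {e | e.1.val = g ∨ e.1.val = g + 1}) := by
  intro ω ω' h
  refine congrArg ind (propext (exists_congr fun j => exists_congr fun k => exists_congr fun l =>
    and_congr_right fun hk => and_congr_right fun hl => and_congr_right fun _ =>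
    and_congr_right fun _ => ?_))
  have h1 : ω (σ (l, j)) = ω' (σ (l, j)) := h _ ⟨_, Or.inr hl, rfl⟩
  have h2 : ω (σ (k, j)) = ω' (σ (k, j)) := h _ ⟨_, Or.inl hk, rfl⟩
  simp only [coinEdges, Set.mem_ofPred_eq, h1, h2]

lemma dependsOn_rightGood (M g : ℕ) :
    DependsOn (fun ω => ind (RightGood (coinEdges σ ω) M g))
      (σ '' {e | e.2.val = g ∨ e.2.val = g + 1}) := by
  intro ω ω' h
  refine congrArg ind (propext (exists_congr fun j => exists_congr fun k => exists_congr fun l =>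
    and_congr_right fun hk => and_congr_right fun hl => and_congr_right fun _ =>
    and_congr_right fun _ => ?_))
  have h1 : ω (σ (j, l)) = ω' (σ (j, l)) := h _ ⟨_, Or.inr hl, rfl⟩
  have h2 : ω (σ (j, k)) = ω' (σ (j, k)) := h _ ⟨_, Or.inl hk, rfl⟩
  simp only [coinEdges, Set.mem_ofPred_eq, h1, h2]

/-- It is exponentially unlikely that all gaps starting at the even vertices `2 * h`, `h ∈ H`, are
good. -/
lemma integral_all_good_le
    (hσ : Function.Injective σ)
    (hr : ∀ e : Fin n × Fin n, e.2 < e.1 → (r (σ e) : ℝ) ≤ p)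
    (hp : 0 ≤ p) {η : ℝ} (h0 : 0 ≤ η) (h1 : η ≤ 1) {M : ℕ}
    (hη : p + M * p ^ 2 ≤ η ^ 2) (H : Finset ℕ) :
    ∫ ω, ind (∀ h ∈ H, LeftGood (coinEdges σ ω) M (2 * h) ∨
      RightGood (coinEdges σ ω) M (2 * h)) ∂coinLaw r ≤ (2 * η) ^ H.card := by
  have hL : ∀ T : Finset ℕ, ∫ ω, ind (∀ h ∈ T, LeftGood (coinEdges σ ω) M (2 * h)) ∂coinLaw r ≤
      (η ^ 2) ^ T.card := fun T =>
    integral_forall_le_pow r T (fun i _ j _ hij => by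
        rw [Set.disjoint_image_iff hσ, Set.disjoint_left]
        rintro e (he | he) (he' | he') <;> omega)
      (fun h _ => dependsOn_leftGood M (2 * h))
      (fun h _ => (integral_leftGood_le r hσ hr hp M (2 * h)).trans hη)
  have hR : ∀ T : Finset ℕ, ∫ ω, ind (∀ h ∈ T, RightGood (coinEdges σ ω) M (2 * h)) ∂coinLaw r ≤
      (η ^ 2) ^ T.card := fun T =>
    integral_forall_le_pow r T (fun i _ j _ hij => by
        rw [Set.disjoint_image_iff hσ, Set.disjoint_left]
        rintro e (he | he) (he' | he') <;> omega)
      (fun h _ => dependsOn_rightGood M (2 * h))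
      (fun h _ => (integral_rightGood_le r hσ hr hp M (2 * h)).trans hη)
  -- Left and right events are dependent, so for each split of `H` only the larger half is kept. The
  -- square in `η ^ 2` compensates for this, and the number of splits gives the factor 2 in `2 * η`.
  have hpow : ∀ k, H.card ≤ 2 * k → (η ^ 2) ^ k ≤ η ^ H.card := fun k hk => by
    rw [← pow_mul]
    exact pow_le_pow_of_le_one h0 h1 hk
  calc _ ≤ ∫ ω, ∑ T ∈ H.powerset, ind ((∀ h ∈ T, LeftGood (coinEdges σ ω) M (2 * h)) ∧
          ∀ h ∈ H \ T, RightGood (coinEdges σ ω) M (2 * h)) ∂coinLaw r := by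
        refine integral_mono_coins r fun ω => (ind_mono fun hω => ?_).trans
          (ind_exists_le_sum _ _)
        classical
        refine ⟨H.filter fun h => LeftGood (coinEdges σ ω) M (2 * h), by simp, ?_, ?_⟩
        · intro h hh
          exact (Finset.mem_filter.1 hh).2
        · intro h hh
          simp only [Finset.mem_sdiff, Finset.mem_filter, not_and] at hh
          exact (hω h hh.1).resolve_left (hh.2 hh.1)
    _ ≤ ∑ T ∈ H.powerset, η ^ H.card := by
        rw [integral_finsetSum _ fun _ _ => .of_finite]
        refine Finset.sum_le_sum fun T hT => ?_
        have hc := Finset.card_sdiff_add_card_eq_card (Finset.mem_powerset.1 hT)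
        rcases le_total H.card (2 * T.card) with h | h
        · exact (integral_mono_coins r fun ω => ind_mono And.left).trans
            ((hL T).trans (hpow _ h))
        · exact (integral_mono_coins r fun ω => ind_mono And.right).trans
            ((hR (H \ T)).trans (hpow _ (by omega)))
    _ = (2 * η) ^ H.card := by
        rw [Finset.sum_const, Finset.card_powerset, nsmul_eq_mul, mul_pow]
        norm_num

/-- Union bound over the left end `a` of the interval of good gaps, which contains at least `X / 2`
gaps starting at even vertices. The map `σ` and the set `Eo` are kept general so that both
orientations are covered. -/
lemma integral_long_edge_le
    (hσ : Function.Injective σ)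
    (hr : ∀ e : Fin n × Fin n, e.2 < e.1 → (r (σ e) : ℝ) ≤ p)
    (hp : 0 ≤ p) {η : ℝ} (h0 : 0 ≤ η) (h1 : η ≤ 1) {X : ℕ} (hX : 1 ≤ X)
    (hη : p + (2 * X : ℕ) * p ^ 2 ≤ η ^ 2) (Eo : Config n → Set (Fin n × Fin n))
    (hEo : ∀ ω, Eo ω ⊆ coinEdges σ ω) (hne : ∀ ω, ∀ e ∈ Eo ω, e.1 ≠ e.2) :
    ∫ ω, ind (∃ e ∈ eventuallyOccupied (lineEdges n) (Eo ω), e.2.val + X < e.1.val) ∂coinLaw r ≤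
      n * (2 * η) ^ (X / 2) := by
  calc _ ≤ ∫ ω, ∑ a ∈ Finset.range n, ind (∀ h ∈ Finset.Ico ((a + 1) / 2) ((a + 1) / 2 + X / 2),
          LeftGood (coinEdges σ ω) (2 * X) (2 * h) ∨
            RightGood (coinEdges σ ω) (2 * X) (2 * h)) ∂coinLaw r := by
        refine integral_mono_coins r fun ω => (ind_mono fun hω => ?_).trans
          (ind_exists_le_sum _ _)
        obtain ⟨e, he, hlen⟩ := hω
        obtain ⟨a, ha, hgood⟩ := exists_good_gaps hX (hne ω) he hlen
        refine ⟨a, Finset.mem_range.2 (by omega), fun h hh => ?_⟩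
        rw [Finset.mem_Ico] at hh
        exact (hgood (2 * h) (by omega) (by omega)).imp (LeftGood.mono (hEo ω))
          (RightGood.mono (hEo ω))
    _ ≤ ∑ a ∈ Finset.range n, (2 * η) ^ (X / 2) := by
        rw [integral_finsetSum _ fun _ _ => .of_finite]
        refine Finset.sum_le_sum fun a _ => ?_
        refine (integral_all_good_le r hσ hr hp h0 h1 hη _).trans_eq ?_
        rw [Nat.card_Ico, Nat.add_sub_cancel_left]
    _ = n * (2 * η) ^ (X / 2) := by rw [Finset.sum_const, Finset.card_range, nsmul_eq_mul]

end Gaps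

/-- The probability of a long leftward edge. -/
lemma integral_long_leftward_le {n : ℕ} (r : Fin n × Fin n → unitInterval) {p : ℝ}
    (hr : ∀ e : Fin n × Fin n, e.2 < e.1 → (r e : ℝ) ≤ p) (hp : 0 ≤ p) {η : ℝ} (h0 : 0 ≤ η)
    (h1 : η ≤ 1) {X : ℕ} (hX : 1 ≤ X) (hη : p + (2 * X : ℕ) * p ^ 2 ≤ η ^ 2) :
    ∫ ω, ind (∃ e ∈ finalEdges ω, IsLeftward e ∧ X < edgeLength e) ∂coinLaw r ≤
      n * (2 * η) ^ (X / 2) := by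
  refine (integral_mono_coins r fun ω => ind_mono ?_).trans
    (integral_long_edge_le r Function.injective_id hr hp h0 h1 hX hη openEdges
      (fun ω e he => he.2.2) (fun ω e he => he.2.1))
  rintro ⟨⟨x, y⟩, he, hl, hlen⟩
  have hl' : y < x := hl
  rw [← edgeLength_swap, Prod.swap_prod_mk, edgeLength_of_le hl'.le] at hlen
  refine ⟨(x, y), he, ?_⟩
  simp only
  omega

/-- The probability of a long rightward edge. -/
lemma integral_long_rightward_le {n : ℕ} (r : Fin n × Fin n → unitInterval) {p : ℝ}
    (hr : ∀ e : Fin n × Fin n, e.1 < e.2 → (r e : ℝ) ≤ p) (hp : 0 ≤ p) {η : ℝ} (h0 : 0 ≤ η)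
    (h1 : η ≤ 1) {X : ℕ} (hX : 1 ≤ X) (hη : p + (2 * X : ℕ) * p ^ 2 ≤ η ^ 2) :
    ∫ ω, ind (∃ e ∈ finalEdges ω, IsRightward e ∧ X < edgeLength e) ∂coinLaw r ≤
      n * (2 * η) ^ (X / 2) := by
  -- With `σ = Prod.swap` the coins are read on the reversed graph, where rightward edges become
  -- leftward.
  refine (integral_mono_coins r fun ω => ind_mono ?_).trans
    (integral_long_edge_le r (σ := Prod.swap) Prod.swap_injective (fun e he => hr _ he) hp h0 h1 hX
      hη (fun ω => Prod.swap ⁻¹' openEdges ω) (fun ω e he => he.2.2) (fun ω e he => he.2.1.symm))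
  rintro ⟨⟨x, y⟩, he, hl, hlen⟩
  have hl' : x < y := hl
  rw [edgeLength_of_le hl'.le] at hlen
  refine ⟨(y, x), ?_, by simp only; omega⟩
  rw [← swap_preimage_lineEdges, eventuallyOccupied_swap]
  exact he

/-! ### Long rightward edges at high density -/

section Stack

/-- The intervals that can be filled from unit intervals by joining two adjacent filled intervals
whenever their union is open. -/
inductive Fill (c : ℕ → ℕ → Bool) : ℕ → ℕ → Prop
  | unit (x : ℕ) : Fill c x (x + 1)
  | join {x z y : ℕ} : c x y = true → Fill c x z → Fill c z y → Fill c x y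

lemma Fill.lt {c : ℕ → ℕ → Bool} {x y : ℕ} (h : Fill c x y) : x < y := by
  induction h with
  | unit x => omega
  | join _ _ _ h1 h2 => omega

/-- Remove the head of a list as long as the next element satisfies `f`. -/
def pop (f : ℕ → Bool) : List ℕ → List ℕ
  | [] => []
  | [a] => [a]
  | a :: b :: l => if f b then pop f (b :: l) else a :: b :: l

/-- The interior vertices, from right to left and including `0`, of a path of filled intervals from
`0` to `y`. -/
def stack (c : ℕ → ℕ → Bool) : ℕ → List ℕ
  | 0 => []
  | y + 1 => pop (fun x => c x (y + 1)) (y :: stack c y)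

/-- The list `l` is a path of filled intervals from `0` to `y`, read backwards and without `y`. -/
def IsFilledPath (c : ℕ → ℕ → Bool) : List ℕ → ℕ → Prop
  | [], y => y = 0
  | a :: l, y => Fill c a y ∧ IsFilledPath c l a

lemma mem_of_mem_pop {f : ℕ → Bool} {l : List ℕ} {x : ℕ} (h : x ∈ pop f l) : x ∈ l := by
  induction l using pop.induct f with
  | case1 => exact h
  | case2 => exact h
  | case3 a b l hb ih =>
    rw [pop, if_pos hb] at h
    exact List.mem_cons_of_mem _ (ih h)
  | case4 a b l hb =>
    rwa [pop, if_neg hb] at h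

lemma pop_congr {f g : ℕ → Bool} {l : List ℕ} (h : ∀ x ∈ l, f x = g x) : pop f l = pop g l := by
  induction l using pop.induct f with
  | case1 => rfl
  | case2 => rfl
  | case3 a b l hb ih =>
    rw [pop, if_pos hb, pop, if_pos (by rw [← h b (by simp), hb]),
      ih fun x hx => h x (List.mem_cons_of_mem _ hx)]
  | case4 a b l hb =>
    rw [pop, if_neg hb, pop, if_neg (by rwa [← h b (by simp)])]

lemma isFilledPath_pop {c : ℕ → ℕ → Bool} {l : List ℕ} {y : ℕ} (h : IsFilledPath c l y) :
    IsFilledPath c (pop (fun x => c x y) l) y := by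
  induction l using pop.induct (fun x => c x y) with
  | case1 => exact h
  | case2 => exact h
  | case3 a b l hb ih =>
    rw [pop, if_pos hb]
    exact ih ⟨.join hb h.2.1 h.1, h.2.2⟩
  | case4 a b l hb =>
    rwa [pop, if_neg hb]

lemma isFilledPath_stack (c : ℕ → ℕ → Bool) (y : ℕ) : IsFilledPath c (stack c y) y := by
  induction y with
  | zero => rfl
  | succ y ih => exact isFilledPath_pop ⟨.unit y, ih⟩

lemma lt_of_mem_stack {c : ℕ → ℕ → Bool} {y x : ℕ} (h : x ∈ stack c y) : x < y := by
  induction y with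
  | zero => simp [stack] at h
  | succ y ih =>
    rcases List.mem_cons.1 (mem_of_mem_pop h) with rfl | h
    · exact Nat.lt_succ_self _
    · exact (ih h).trans (Nat.lt_succ_self _)

lemma stack_congr {c d : ℕ → ℕ → Bool} {y : ℕ} (h : ∀ u v, u < v → v ≤ y → c u v = d u v) :
    stack c y = stack d y := by
  induction y with
  | zero => rfl
  | succ y ih =>
    rw [stack, stack, ← ih fun u v huv hv => h u v huv (by omega)]
    refine pop_congr fun x hx => h x (y + 1) ?_ le_rfl
    rcases List.mem_cons.1 hx with rfl | hx
    · omega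
    · have := lt_of_mem_stack hx
      omega

/-- A path of filled intervals from `0` to `y > 0` with at most one interval is that single
interval. -/
lemma fill_of_length_stack_lt_two {c : ℕ → ℕ → Bool} {y : ℕ} (hy : 0 < y)
    (h : (stack c y).length < 2) : Fill c 0 y := by
  have hp := isFilledPath_stack c y
  rcases hl : stack c y with _ | ⟨a, _ | ⟨b, l⟩⟩
  · rw [hl] at hp
    exact absurd hp hy.ne'
  · rw [hl] at hp
    obtain ⟨h1, h2⟩ := hp
    exact (show a = 0 from h2) ▸ h1
  · rw [hl] at h
    simp at h

/-- The number of `k ≤ y` with a stack of length at least two. -/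
def longCount (c : ℕ → ℕ → Bool) (y : ℕ) : ℕ :=
  ((Finset.range (y + 1)).filter fun k => 2 ≤ (stack c k).length).card

lemma longCount_succ (c : ℕ → ℕ → Bool) (y : ℕ) :
    longCount c (y + 1) = longCount c y + if 2 ≤ (stack c (y + 1)).length then 1 else 0 := by
  unfold longCount
  rw [Finset.range_add_one, Finset.filter_insert]
  split_ifs
  · rw [Finset.card_insert_of_notMem (by simp)]
  · rfl

lemma longCount_congr {c d : ℕ → ℕ → Bool} {y : ℕ} (h : ∀ u v, u < v → v ≤ y → c u v = d u v) :
    longCount c y = longCount d y := by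
  unfold longCount
  congr 1
  refine Finset.filter_congr fun k hk => ?_
  rw [stack_congr fun u v huv hv => h u v huv (hv.trans (Nat.lt_succ_iff.1 (Finset.mem_range.1 hk)))]

/-- The total weight of the occurrences of `x` in a list. -/
def popWeight : List ℕ → ℕ → ℝ
  | [], _ => 0
  | b :: l, x => (if b = x then 2 ^ (l.length + 2) else 0) + popWeight l x

lemma popWeight_nonneg (l : List ℕ) (x : ℕ) : 0 ≤ popWeight l x := by
  induction l with
  | nil => exact le_rfl
  | cons b l ih =>
    unfold popWeight
    split_ifs <;> positivity

/-- The weights along the list are distinct powers of two, so the geometric series is dominated by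
its first term. -/
lemma sum_popWeight_le (s : Finset ℕ) (l : List ℕ) :
    ∑ x ∈ s, popWeight l x ≤ 4 * 2 ^ l.length := by
  induction l with
  | nil => simp [popWeight]
  | cons b l ih =>
    simp only [popWeight, Finset.sum_add_distrib, Finset.sum_ite_eq, List.length_cons]
    have : (if b ∈ s then (2 : ℝ) ^ (l.length + 2) else 0) ≤ 2 ^ (l.length + 2) := by
      split_ifs
      · exact le_rfl
      · positivity
    have h2 : (2 : ℝ) ^ (l.length + 2) = 4 * 2 ^ l.length := by ring
    have h1 : (2 : ℝ) ^ (l.length + 1) = 2 * 2 ^ l.length := by ring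
    linarith

/-- Either everything merges into one interval, which contributes 2, or merging stops at some `b`
with `f b = false`. In the second case the new length is exactly the exponent in the weight of `b`.
Summing over all possible `b` avoids any conditioning on where the merging stops. -/
lemma length_pop_bound {θ : ℝ} (hθ : 1 ≤ θ) (f : ℕ → Bool) (s : Finset ℕ) (t : List ℕ) :
    ∀ a, (∀ x ∈ t, x ∈ s) →
    θ ^ (if 2 ≤ (pop f (a :: t)).length then 1 else 0) * 2 ^ (pop f (a :: t)).length ≤
      2 + θ * ∑ x ∈ s, popWeight t x * ind (f x = false) := by
  induction t with
  | nil => intro a _; simp [pop, popWeight]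
  | cons b l ih =>
    intro a hs
    have hnn : ∀ t, 0 ≤ ∑ x ∈ s, popWeight t x * ind (f x = false) := fun t =>
      Finset.sum_nonneg fun x _ => mul_nonneg (popWeight_nonneg _ _) (ind_nonneg _)
    by_cases hb : f b = true
    · rw [pop, if_pos hb]
      refine (ih b fun x hx => hs x (List.mem_cons_of_mem _ hx)).trans ?_
      gcongr with x _
      · exact ind_nonneg _
      · rw [popWeight]
        split_ifs <;> simp
    · rw [pop, if_neg hb]
      have hle : (2 : ℝ) ^ (l.length + 2) ≤ ∑ x ∈ s, popWeight (b :: l) x * ind (f x = false) := by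
        refine le_trans ?_ (Finset.single_le_sum
          (f := fun x => popWeight (b :: l) x * ind (f x = false))
          (fun x _ => mul_nonneg (popWeight_nonneg _ _) (ind_nonneg _)) (hs b (by simp)))
        simp only [popWeight, if_true, ind_true (by simpa using hb : f b = false), mul_one]
        linarith [popWeight_nonneg l b]
      simp only [List.length_cons, show 2 ≤ l.length + 1 + 1 by omega, if_true, pow_one]
      nlinarith

variable {ι : Type*} [Fintype ι] (r : ι → unitInterval) {f : ℕ → ℕ → ι} {L : ℕ}
  {q θ : ℝ}

/-- Each step multiplies the moment by at most 6. Full collapse contributes 2. Stopping at `x` needs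
the coin of `x → y + 1`, which is independent of the stack at `y`, to be `false`; summed over `x`
this contributes at most `4 * θ * q ≤ 4`. -/
lemma integral_stack_le
    (hf : ∀ x y x' y', x < y → y ≤ L → x' < y' → y' ≤ L → f x y = f x' y' → x = x' ∧ y = y')
    (hq : ∀ x y, x < y → y ≤ L → 1 - (r (f x y) : ℝ) ≤ q)
    (hθ : 1 ≤ θ) (hθq : θ * q ≤ 1) {y : ℕ} (hy : y ≤ L) :
    ∫ ω, θ ^ longCount (fun u v => ω (f u v)) y *
      2 ^ (stack (fun u v => ω (f u v)) y).length ∂coinLaw r ≤ 6 ^ y := by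
  have hθ0 : 0 ≤ θ := by linarith
  induction y with
  | zero =>
    have h0 : ∀ c, longCount c 0 = 0 := fun c => by simp [longCount, Finset.filter_singleton, stack]
    simp [stack, h0]
  | succ y ih =>
    have ih := ih (by omega)
    set c : (ι → Bool) → ℕ → ℕ → Bool := fun ω u v => ω (f u v) with hc
    have hcoin : ∀ x ∈ Finset.range y,
        ∫ ω, θ ^ longCount (c ω) y * popWeight (stack (c ω) y) x *
          ind (c ω x (y + 1) = false) ∂coinLaw r ≤
        (∫ ω, θ ^ longCount (c ω) y * popWeight (stack (c ω) y) x ∂coinLaw r) * q := by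
      intro x hx
      have hx' := Finset.mem_range.1 hx
      rw [integral_mul_of_dependsOn r
        (s := {i | ∃ u v, u < v ∧ v ≤ y ∧ i = f u v}) (t := {f x (y + 1)})]
      · rw [integral_ind_false]
        refine mul_le_mul_of_nonneg_left (hq x (y + 1) (by omega) hy) (integral_nonneg fun ω => ?_)
        exact mul_nonneg (pow_nonneg hθ0 _) (popWeight_nonneg _ _)
      · rw [Set.disjoint_singleton_right]
        rintro ⟨u, v, huv, hv, h⟩
        have := hf x (y + 1) u v (by omega) hy huv (by omega) h
        omega
      · intro ω ω' h
        have h' : ∀ u v, u < v → v ≤ y → c ω u v = c ω' u v :=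
          fun u v huv hv => h _ ⟨u, v, huv, hv, rfl⟩
        simp only [longCount_congr h', stack_congr h']
      · intro ω ω' h
        simp only [hc, h _ rfl]
    calc ∫ ω, θ ^ longCount (c ω) (y + 1) * 2 ^ (stack (c ω) (y + 1)).length ∂coinLaw r
        ≤ ∫ ω, (2 * (θ ^ longCount (c ω) y * 2 ^ (stack (c ω) y).length) +
            θ * ∑ x ∈ Finset.range y, θ ^ longCount (c ω) y * popWeight (stack (c ω) y) x *
              ind (c ω x (y + 1) = false)) ∂coinLaw r := by
          refine integral_mono_coins r fun ω => ?_
          have h1 := length_pop_bound hθ (fun x => c ω x (y + 1)) (Finset.range y)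
            (stack (c ω) y) y fun x hx => Finset.mem_range.2 (lt_of_mem_stack hx)
          have h2 : (1 : ℝ) ≤ 2 ^ (stack (c ω) y).length := one_le_pow₀ (by norm_num)
          have h3 : 0 ≤ θ ^ longCount (c ω) y := pow_nonneg hθ0 _
          rw [longCount_succ, pow_add, mul_assoc]
          simp only [mul_assoc, ← Finset.mul_sum]
          refine (mul_le_mul_of_nonneg_left h1 h3).trans ?_
          nlinarith
      _ = 2 * ∫ ω, θ ^ longCount (c ω) y * 2 ^ (stack (c ω) y).length ∂coinLaw r +
            θ * ∑ x ∈ Finset.range y, ∫ ω, θ ^ longCount (c ω) y * popWeight (stack (c ω) y) x *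
              ind (c ω x (y + 1) = false) ∂coinLaw r := by
          rw [integral_add .of_finite .of_finite, integral_const_mul, integral_const_mul,
            integral_finsetSum _ fun _ _ => .of_finite]
      _ ≤ 2 * ∫ ω, θ ^ longCount (c ω) y * 2 ^ (stack (c ω) y).length ∂coinLaw r +
            θ * ∑ x ∈ Finset.range y,
              (∫ ω, θ ^ longCount (c ω) y * popWeight (stack (c ω) y) x ∂coinLaw r) * q := by
          gcongr with x hx
          exact hcoin x hx
      _ = 2 * ∫ ω, θ ^ longCount (c ω) y * 2 ^ (stack (c ω) y).length ∂coinLaw r +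
            (θ * q) * ∫ ω, θ ^ longCount (c ω) y *
              ∑ x ∈ Finset.range y, popWeight (stack (c ω) y) x ∂coinLaw r := by
          simp only [Finset.mul_sum]
          rw [integral_finsetSum _ fun _ _ => .of_finite, ← Finset.mul_sum, ← Finset.sum_mul]
          ring
      _ ≤ 2 * ∫ ω, θ ^ longCount (c ω) y * 2 ^ (stack (c ω) y).length ∂coinLaw r +
            1 * ∫ ω, 4 * (θ ^ longCount (c ω) y * 2 ^ (stack (c ω) y).length) ∂coinLaw r := by
          have hnn : 0 ≤ ∫ ω, θ ^ longCount (c ω) y *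
              ∑ x ∈ Finset.range y, popWeight (stack (c ω) y) x ∂coinLaw r :=
            integral_nonneg fun ω => mul_nonneg (pow_nonneg hθ0 _)
              (Finset.sum_nonneg fun x _ => popWeight_nonneg _ _)
          refine add_le_add le_rfl (mul_le_mul hθq ?_ hnn zero_le_one)
          refine integral_mono_coins r fun ω => ?_
          have h3 : 0 ≤ θ ^ longCount (c ω) y := pow_nonneg hθ0 _
          have := mul_le_mul_of_nonneg_left
            (sum_popWeight_le (Finset.range y) (stack (c ω) y)) h3
          linarith
      _ ≤ 6 ^ (y + 1) := by
          rw [integral_const_mul, pow_succ]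
          linarith

/-- Markov's inequality with `θ = 1 / s ^ 2`: having at least `y / 2` long stacks makes the moment
at least `s ^ (-y)`. -/
lemma integral_longCount_ge_le
    (hf : ∀ x y x' y', x < y → y ≤ L → x' < y' → y' ≤ L → f x y = f x' y' → x = x' ∧ y = y')
    (hq : ∀ x y, x < y → y ≤ L → 1 - (r (f x y) : ℝ) ≤ q)
    {s : ℝ} (hs0 : 0 < s) (hs1 : s ≤ 1) (hqs : q ≤ s ^ 2) {y : ℕ}
    (hy : y ≤ L) :
    ∫ ω, ind (y ≤ 2 * longCount (fun u v => ω (f u v)) y) ∂coinLaw r ≤ (6 * s) ^ y := by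
  have hs2 : 0 < s ^ 2 := by positivity
  have hθ : 1 ≤ 1 / s ^ 2 := by
    rw [le_div_iff₀ hs2]
    nlinarith
  have hmain := integral_stack_le r hf hq hθ (by rw [one_div_mul_eq_div, div_le_one hs2]; exact hqs)
    hy
  calc _ ≤ ∫ ω, s ^ y * ((1 / s ^ 2) ^ longCount (fun u v => ω (f u v)) y *
          2 ^ (stack (fun u v => ω (f u v)) y).length) ∂coinLaw r := by
        refine integral_mono_coins r fun ω => ?_
        set N := longCount (fun u v => ω (f u v)) y
        by_cases h : y ≤ 2 * N
        · rw [ind_true h]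
          have h1 : s ^ (2 * N) ≤ s ^ y := pow_le_pow_of_le_one hs0.le hs1 h
          have h2 : s ^ (2 * N) * (1 / s ^ 2) ^ N = 1 := by
            rw [pow_mul, ← mul_pow, mul_one_div_cancel hs2.ne', one_pow]
          have h3 : 1 ≤ s ^ y * (1 / s ^ 2) ^ N := by
            refine h2.symm.le.trans ?_
            gcongr
          rw [← mul_assoc]
          exact one_le_mul_of_one_le_of_one_le h3 (one_le_pow₀ (by norm_num))
        · rw [ind_false h]
          positivity
    _ ≤ (6 * s) ^ y := by
        rw [integral_const_mul, mul_pow, mul_comm (6 ^ y)]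
        gcongr

end Stack

/-! ### Filling a rightward edge from both of its ends -/

section Rightward

variable {n : ℕ}

/-- The vertex of `Fin n` with value `k`, for `k < n`. -/
def vertex (i : Fin n) (k : ℕ) : Fin n := ⟨min k (n - 1), by have := i.2; omega⟩

lemma vertex_val (i : Fin n) {k : ℕ} (hk : k < n) : (vertex i k).val = k := by
  simp only [vertex]; omega

lemma Fill.mem_finalEdges {ω : Config n} (i : Fin n) {a x y : ℕ}
    (h : Fill (fun u v => ω (vertex i (a + u), vertex i (a + v))) x y) (hy : a + y < n) :
    (vertex i (a + x), vertex i (a + y)) ∈ finalEdges ω := by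
  induction h with
  | unit x =>
    refine subset_eventuallyOccupied (mem_lineEdges.2 (Or.inl ?_))
    simp only
    rw [vertex_val i (by omega), vertex_val i hy]
    omega
  | join hc h1 h2 ih1 ih2 =>
    have l1 := h1.lt
    have l2 := h2.lt
    refine eventuallyOccupied_join (mem_line_or_open (fun h => ?_) hc) (ih1 (by omega)) (ih2 hy)
    have := congrArg Fin.val h
    rw [vertex_val i (by omega), vertex_val i hy] at this
    omega

/-- Stacks always start at `0`, so intervals with a fixed right end `b` are handled in mirrored
coordinates; the two halves of a join change places. -/
lemma Fill.mem_finalEdges_of_reflected {ω : Config n} (i : Fin n) {b x y : ℕ}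
    (h : Fill (fun u v => ω (vertex i (b - v), vertex i (b - u))) x y) (hb : b < n) (hy : y ≤ b) :
    (vertex i (b - y), vertex i (b - x)) ∈ finalEdges ω := by
  induction h with
  | unit x =>
    refine subset_eventuallyOccupied (mem_lineEdges.2 (Or.inl ?_))
    simp only
    rw [vertex_val i (by omega), vertex_val i (by omega)]
    omega
  | join hc h1 h2 ih1 ih2 =>
    have l1 := h1.lt
    have l2 := h2.lt
    refine eventuallyOccupied_join (mem_line_or_open (fun h => ?_) hc) (ih2 hy) (ih1 (by omega))
    have := congrArg Fin.val h
    rw [vertex_val i (by omega), vertex_val i (by omega)] at this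
    omega

/-- If an interval cannot be filled, many stacks from one of its ends are long. -/
lemma longCount_of_not_mem {ω : Config n} {i j : Fin n} {m : ℕ} (hij : i.val + (m + 1) = j.val)
    (ho : (i, j) ∈ openEdges ω) (hn : (i, j) ∉ finalEdges ω) :
    m ≤ 2 * longCount (fun u v => ω (vertex i (i.val + u), vertex i (i.val + v))) m ∨
      m ≤ 2 * longCount (fun u v => ω (vertex i (j.val - v), vertex i (j.val - u))) m := by
  set c := fun u v => ω (vertex i (i.val + u), vertex i (i.val + v))
  set d := fun u v => ω (vertex i (j.val - v), vertex i (j.val - u))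
  have hvi : vertex i i.val = i := Fin.ext (vertex_val i i.2)
  have hvj : vertex i j.val = j := Fin.ext (vertex_val i j.2)
  -- If both stacks meeting at an interior vertex were short, the two edges through that vertex
  -- would be occupied, and so would the open edge `(i, j)`. Hence the two counts add up to at least
  -- `m`.
  have hsub : Finset.Icc 1 m ⊆
      ((Finset.range (m + 1)).filter fun k => 2 ≤ (stack c k).length) ∪
      ((Finset.range (m + 1)).filter fun k => 2 ≤ (stack d k).length).image fun k => m + 1 - k := by
    intro k hk
    rw [Finset.mem_Icc] at hk
    by_contra hcon
    simp only [Finset.mem_union, Finset.mem_filter, Finset.mem_range, Finset.mem_image, not_or,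
      not_and, not_exists, not_le] at hcon
    have h1 : Fill c 0 k := fill_of_length_stack_lt_two (by omega) (hcon.1 (by omega))
    have h2 : Fill d 0 (m + 1 - k) := by
      refine fill_of_length_stack_lt_two (by omega) ?_
      by_contra h
      exact hcon.2 (m + 1 - k) ⟨by omega, by omega⟩ (by omega)
    have e1 := h1.mem_finalEdges i (by omega)
    have e2 := h2.mem_finalEdges_of_reflected i j.2 (by omega)
    rw [Nat.add_zero, hvi] at e1
    rw [Nat.sub_zero, hvj, show j.val - (m + 1 - k) = i.val + k by omega] at e2
    exact hn (eventuallyOccupied_join (Or.inr ho) e1 e2)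
  have hcard := (Finset.card_le_card hsub).trans (Finset.card_union_le _ _)
  have himg : (((Finset.range (m + 1)).filter fun k => 2 ≤ (stack d k).length).image
      fun k => m + 1 - k).card ≤ longCount d m := Finset.card_image_le
  rw [Nat.card_Icc] at hcard
  have : m ≤ longCount c m + longCount d m := by
    unfold longCount at *
    omega
  omega

/-- The probability that some long open rightward edge is never occupied. -/
lemma integral_unfilled_le (r : Fin n × Fin n → unitInterval) {s : ℝ} (hs0 : 0 < s)
    (hs1 : 6 * s ≤ 1) (hr : ∀ e : Fin n × Fin n, e.1 < e.2 → 1 - (r e : ℝ) ≤ s ^ 2) (X : ℕ) :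
    ∫ ω, ind (∃ e ∈ openEdges ω, IsRightward e ∧ X < edgeLength e ∧ e ∉ finalEdges ω) ∂coinLaw r ≤
      n ^ 2 * (2 * (6 * s) ^ X) := by
  have hone : ∀ e : Fin n × Fin n, ∫ ω, ind (e ∈ openEdges ω ∧ IsRightward e ∧ X < edgeLength e ∧
      e ∉ finalEdges ω) ∂coinLaw r ≤ 2 * (6 * s) ^ X := by
    rintro ⟨i, j⟩
    by_cases h : i < j ∧ X < edgeLength (i, j)
    · obtain ⟨hij, hX⟩ := h
      rw [edgeLength_of_le hij.le] at hX
      have hij' : i.val < j.val := hij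
      obtain ⟨m, hm⟩ : ∃ m, i.val + (m + 1) = j.val := ⟨j.val - i.val - 1, by omega⟩
      have hj := j.2
      have hc : ∫ ω, ind (m ≤ 2 * longCount
          (fun u v => ω (vertex i (i.val + u), vertex i (i.val + v))) m) ∂coinLaw r ≤
          (6 * s) ^ m := by
        refine integral_longCount_ge_le r (f := fun u v => (vertex i (i.val + u),
          vertex i (i.val + v))) (L := m) ?_ (q := s ^ 2) ?_ hs0 (by linarith) le_rfl le_rfl
        · intro x y x' y' hxy hy hxy' hy' h
          rw [Prod.mk.injEq, Fin.ext_iff, Fin.ext_iff, vertex_val i (by omega),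
            vertex_val i (by omega), vertex_val i (by omega), vertex_val i (by omega)] at h
          omega
        · intro x y hxy hy
          refine hr _ ?_
          simp only [Fin.lt_def]
          rw [vertex_val i (by omega), vertex_val i (by omega)]
          omega
      have hd : ∫ ω, ind (m ≤ 2 * longCount
          (fun u v => ω (vertex i (j.val - v), vertex i (j.val - u))) m) ∂coinLaw r ≤
          (6 * s) ^ m := by
        refine integral_longCount_ge_le r (f := fun u v => (vertex i (j.val - v),
          vertex i (j.val - u))) (L := m) ?_ (q := s ^ 2) ?_ hs0 (by linarith) le_rfl le_rfl
        · intro x y x' y' hxy hy hxy' hy' h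
          rw [Prod.mk.injEq, Fin.ext_iff, Fin.ext_iff, vertex_val i (by omega),
            vertex_val i (by omega), vertex_val i (by omega), vertex_val i (by omega)] at h
          omega
        · intro x y hxy hy
          refine hr _ ?_
          simp only [Fin.lt_def]
          rw [vertex_val i (by omega), vertex_val i (by omega)]
          omega
      have hpow : (6 * s) ^ m ≤ (6 * s) ^ X :=
        pow_le_pow_of_le_one (by linarith) hs1 (by omega)
      calc _ ≤ ∫ ω, (ind (m ≤ 2 * longCount
              (fun u v => ω (vertex i (i.val + u), vertex i (i.val + v))) m) +
            ind (m ≤ 2 * longCount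
              (fun u v => ω (vertex i (j.val - v), vertex i (j.val - u))) m)) ∂coinLaw r :=
            integral_mono_coins r fun ω => (ind_mono fun hω =>
              longCount_of_not_mem hm hω.1 hω.2.2.2).trans (ind_or_le _ _)
        _ ≤ 2 * (6 * s) ^ X := by
            rw [integral_add .of_finite .of_finite]
            linarith
    · have : ∀ ω : Config n, ind ((i, j) ∈ openEdges ω ∧ IsRightward (i, j) ∧
          X < edgeLength (i, j) ∧ (i, j) ∉ finalEdges ω) = 0 :=
        fun ω => ind_false fun hω => h ⟨hω.2.1, hω.2.2.1⟩
      simp only [this, integral_zero]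
      positivity
  calc _ ≤ ∫ ω, ∑ e : Fin n × Fin n, ind (e ∈ openEdges ω ∧ IsRightward e ∧ X < edgeLength e ∧
          e ∉ finalEdges ω) ∂coinLaw r := by
        refine integral_mono_coins r fun ω => (ind_mono ?_).trans (ind_exists_le_sum _ _)
        rintro ⟨e, he⟩
        exact ⟨e, Finset.mem_univ _, he⟩
    _ ≤ ∑ _e : Fin n × Fin n, 2 * (6 * s) ^ X := by
        rw [integral_finsetSum _ fun _ _ => .of_finite]
        exact Finset.sum_le_sum fun e _ => hone e
    _ = n ^ 2 * (2 * (6 * s) ^ X) := by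
        rw [Finset.sum_const, Finset.card_univ, Fintype.card_prod, Fintype.card_fin, nsmul_eq_mul]
        push_cast
        ring

end Rightward

/-! ### Directed connectivity of random neighbourhoods -/

lemma exp_neg_le_one_sub_half {u : ℝ} (h0 : 0 ≤ u) (h1 : u ≤ 1) : Real.exp (-u) ≤ 1 - u / 2 := by
  rw [Real.exp_neg, inv_le_comm₀ (Real.exp_pos u) (by linarith)]
  refine le_trans ?_ (Real.add_one_le_exp u)
  rw [inv_le_comm₀ (by linarith) (by linarith), ← one_div, div_le_iff₀ (by linarith)]
  nlinarith

lemma sum_pow_succ_le {z : ℝ} (h0 : 0 ≤ z) (h1 : z ≤ 1 / 2) (m : ℕ) :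
    ∑ i ∈ Finset.range m, z ^ (i + 1) ≤ 2 * z := by
  calc ∑ i ∈ Finset.range m, z ^ (i + 1) ≤ ∑ i ∈ Finset.range m, (1 / 2 : ℝ) ^ i * z := by
        refine Finset.sum_le_sum fun i _ => ?_
        rw [pow_succ]
        gcongr
    _ ≤ 2 * z := by
        rw [← Finset.sum_mul]
        gcongr
        exact sum_geometric_two_le m

/-- The expected number of cuts in a random directed graph. -/
lemma sum_cuts_le {p : ℝ} (hp : 0 ≤ p) (m : ℕ) (hz : m * Real.exp (-(p * m / 2)) ≤ 1 / 2) :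
    ∑ k ∈ Finset.range (m + 1),
      (m.choose k : ℝ) * (if k = 0 then 0 else Real.exp (-p) ^ (k * (m + 1 - k))) ≤
      4 * (m * Real.exp (-(p * m / 2))) := by
  set u := Real.exp (-(p * m / 2)) with hu
  set z := m * u with hzdef
  have hz0 : 0 ≤ z := by positivity
  -- In `k * (m + 1 - k)` the larger factor is at least `m / 2`, while the binomial coefficient is
  -- at most `m` to the smaller factor. Both ends of the range thus give geometric series in `z`.
  have hterm : ∀ i ∈ Finset.range m, (m.choose (i + 1) : ℝ) *
      Real.exp (-p) ^ ((i + 1) * (m + 1 - (i + 1))) ≤ z ^ (i + 1) + z ^ (m - 1 - i + 1) := by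
    intro i hi
    have hi := Finset.mem_range.1 hi
    have hexp : ∀ a b : ℕ, (m : ℝ) ≤ 2 * b → Real.exp (-p) ^ (a * b) ≤ u ^ a := by
      intro a b hb
      rw [mul_comm a b, pow_mul]
      refine pow_le_pow_left₀ (by positivity) ?_ a
      rw [← Real.exp_nat_mul, hu, Real.exp_le_exp]
      nlinarith
    rcases le_total (2 * (i + 1)) (m + 1) with h | h
    · have h1 : Real.exp (-p) ^ ((i + 1) * (m + 1 - (i + 1))) ≤ u ^ (i + 1) :=
        hexp _ _ (by exact_mod_cast (by omega : m ≤ 2 * (m + 1 - (i + 1))))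
      have h2 : (m.choose (i + 1) : ℝ) ≤ (m : ℝ) ^ (i + 1) := by
        exact_mod_cast Nat.choose_le_pow m (i + 1)
      calc _ ≤ (m : ℝ) ^ (i + 1) * u ^ (i + 1) := by gcongr
        _ = z ^ (i + 1) := (mul_pow _ _ _).symm
        _ ≤ _ := le_add_of_nonneg_right (by positivity)
    · have h1 : Real.exp (-p) ^ ((i + 1) * (m + 1 - (i + 1))) ≤ u ^ (m - 1 - i + 1) := by
        rw [mul_comm, show m + 1 - (i + 1) = m - 1 - i + 1 by omega]
        exact hexp _ _ (by exact_mod_cast (by omega : m ≤ 2 * (i + 1)))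
      have h2 : (m.choose (i + 1) : ℝ) ≤ (m : ℝ) ^ (m - 1 - i + 1) := by
        rw [← Nat.choose_symm (by omega : i + 1 ≤ m)]
        have h3 : m.choose (m - (i + 1)) ≤ m ^ (m - (i + 1)) := Nat.choose_le_pow _ _
        have h4 : m ^ (m - (i + 1)) ≤ m ^ (m - 1 - i + 1) :=
          Nat.pow_le_pow_right (by omega) (by omega)
        exact_mod_cast h3.trans h4
      calc _ ≤ (m : ℝ) ^ (m - 1 - i + 1) * u ^ (m - 1 - i + 1) := by gcongr
        _ = z ^ (m - 1 - i + 1) := (mul_pow _ _ _).symm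
        _ ≤ _ := le_add_of_nonneg_left (by positivity)
  rw [Finset.sum_range_succ']
  simp only [Nat.add_eq_zero_iff, one_ne_zero, and_false, if_false, if_true, mul_zero, add_zero]
  refine (Finset.sum_le_sum hterm).trans ?_
  rw [Finset.sum_add_distrib, Finset.sum_range_reflect (fun i => z ^ (i + 1))]
  linarith [sum_pow_succ_le hz0 hz m]

section Cut

variable {ι V : Type*} [DecidableEq V] {f : V → V → ι}

/-- The vertices of `R` with an open edge to `w` cannot all reach `b` through such vertices: some
nonempty set `S` of them sends no open edge to the others and to `b`. -/
def CutFail (f : V → V → ι) (R : Finset V) (b w : V) (ω : ι → Bool) : Prop :=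
  ∃ S ⊆ R.filter fun x => ω (f x w) = true, S.Nonempty ∧
    ∀ x ∈ S, ∀ y ∈ insert b (R.filter fun x => ω (f x w) = true) \ S, ω (f x y) = false

/-- The set of counterexamples would itself be a cut: an open edge from it to a vertex satisfying
`P` would propagate `P` backwards. -/
lemma reaches_of_not_cutFail {R : Finset V} {b w : V} {ω : ι → Bool} (h : ¬ CutFail f R b w ω)
    {P : V → Prop} (hb : P b)
    (hstep : ∀ x ∈ R, ω (f x w) = true → ∀ y ∈ insert b R, ω (f x y) = true → P y → P x) :
    ∀ x ∈ R, ω (f x w) = true → P x := by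
  classical
  by_contra hcon
  push Not at hcon
  obtain ⟨x, hx, hxw, hPx⟩ := hcon
  refine h ⟨(R.filter fun x => ω (f x w) = true).filter fun x => ¬ P x, Finset.filter_subset _ _,
    ⟨x, by simp [hx, hxw, hPx]⟩, fun u hu y hy => ?_⟩
  simp only [Finset.mem_filter, Finset.mem_sdiff, Finset.mem_insert, not_and, not_not] at hu hy
  by_contra hne
  rw [Bool.not_eq_false] at hne
  refine hu.2 (hstep u hu.1.1 hu.1.2 y ?_ hne ?_)
  · exact Finset.mem_insert.2 (hy.1.imp_right And.left)
  · rcases hy.1 with rfl | h'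
    · exact hb
    · exact hy.2 h'

variable [Fintype ι] (r : ι → unitInterval) {p : ℝ}

/-- First moment over cuts: a set of size `k` needs `k * (N.card + 1 - k)` prescribed coins to be
`false`, each with probability at most `exp (-p)`. -/
lemma integral_cut_le (hf : Function.Injective2 f) (hp0 : 0 ≤ p) (hr : ∀ i, p ≤ r i)
    (N : Finset V) {b : V} (hb : b ∉ N) :
    ∫ ω, ind (∃ S ⊆ N, S.Nonempty ∧ ∀ x ∈ S, ∀ y ∈ insert b N \ S, ω (f x y) = false) ∂coinLaw r ≤
      4 * (N.card * Real.exp (-(p * N.card / 2))) := by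
  rcases le_total (N.card * Real.exp (-(p * N.card / 2))) (1 / 2) with hz | hz
  · have hS : ∀ S ∈ N.powerset, ∫ ω, ind (S.Nonempty ∧
        ∀ x ∈ S, ∀ y ∈ insert b N \ S, ω (f x y) = false) ∂coinLaw r ≤
        (if S.card = 0 then 0 else Real.exp (-p) ^ (S.card * (N.card + 1 - S.card))) := by
      intro S hS
      have hSN := Finset.mem_powerset.1 hS
      split_ifs with h0
      · have : ∀ ω : ι → Bool, ind (S.Nonempty ∧
            ∀ x ∈ S, ∀ y ∈ insert b N \ S, ω (f x y) = false) = 0 := fun ω =>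
          ind_false fun h => h.1.ne_empty (Finset.card_eq_zero.1 h0)
        simp only [this, integral_zero]
        exact le_rfl
      · have hcard : (S ×ˢ (insert b N \ S)).card = S.card * (N.card + 1 - S.card) := by
          rw [Finset.card_product, Finset.card_sdiff_of_subset
            (hSN.trans (Finset.subset_insert b N)), Finset.card_insert_of_notMem hb]
        rw [← hcard]
        refine (integral_mono_coins r fun ω => ind_mono fun h => ?_).trans
          (integral_forall_le_pow r (S ×ˢ (insert b N \ S))
            (P := fun e ω => ω (f e.1 e.2) = false) (s := fun e => {f e.1 e.2}) ?_ ?_ ?_)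
        · intro e he
          rw [Finset.mem_product] at he
          exact h.2 e.1 he.1 e.2 he.2
        · intro i _ j _ hij
          rw [Set.disjoint_singleton]
          exact fun h => hij (Prod.ext (hf h).1 (hf h).2)
        · intro e _ ω ω' h
          simp only [h _ rfl]
        · intro e _
          rw [integral_ind_false]
          linarith [hr (f e.1 e.2), Real.add_one_le_exp (-p)]
    calc _ ≤ ∫ ω, ∑ S ∈ N.powerset, ind (S.Nonempty ∧
            ∀ x ∈ S, ∀ y ∈ insert b N \ S, ω (f x y) = false) ∂coinLaw r := by
          refine integral_mono_coins r fun ω => (ind_mono ?_).trans (ind_exists_le_sum _ _)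
          rintro ⟨S, hS, h⟩
          exact ⟨S, Finset.mem_powerset.2 hS, h⟩
      _ ≤ ∑ S ∈ N.powerset,
            (if S.card = 0 then 0 else Real.exp (-p) ^ (S.card * (N.card + 1 - S.card))) := by
          rw [integral_finsetSum _ fun _ _ => .of_finite]
          exact Finset.sum_le_sum hS
      _ ≤ _ := by
          rw [Finset.sum_powerset_apply_card (fun k => if k = 0 then (0 : ℝ) else
            Real.exp (-p) ^ (k * (N.card + 1 - k)))]
          simp only [nsmul_eq_mul]
          exact sum_cuts_le hp0 _ hz
  -- Here the claimed bound is at least 2, so there is nothing to estimate.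
  · refine (integral_mono_coins r fun ω => ind_le_one _).trans ?_
    simp only [integral_const, probReal_univ, one_smul]
    linarith

/-- The neighbourhood of `w` is decided by coins `f x w`, the cuts by coins `f x y` with `y ≠ w`. So
one may fix the neighbourhood `N`, apply the cut bound, and average `exp (-p * N.card / 2)` as a
product over the vertices of `R`. -/
lemma integral_cutFail_le (hf : Function.Injective2 f) (hp0 : 0 ≤ p) (hp1 : p ≤ 1)
    (hr : ∀ i, p ≤ r i) (R : Finset V) {b w : V} (hb : b ∉ R) (hw : w ∉ R) (hbw : b ≠ w) :
    ∫ ω, ind (CutFail f R b w ω) ∂coinLaw r ≤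
      4 * R.card * Real.exp (-(p ^ 2 / 4)) ^ R.card := by
  set O : (ι → Bool) → Finset V := fun ω => R.filter fun x => ω (f x w) = true with hO
  set y := Real.exp (-(p / 2)) with hy
  set cut : Finset V → (ι → Bool) → Prop := fun N ω =>
    ∃ S ⊆ N, S.Nonempty ∧ ∀ x ∈ S, ∀ y ∈ insert b N \ S, ω (f x y) = false with hcut
  have hN : ∀ N ∈ R.powerset, ∫ ω, ind (O ω = N ∧ cut N ω) ∂coinLaw r ≤
      ∫ ω, 4 * R.card * (ind (O ω = N) * y ^ N.card) ∂coinLaw r := by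
    intro N hN
    have hNR := Finset.mem_powerset.1 hN
    simp only [ind_and]
    rw [integral_mul_of_dependsOn r (s := {i | ∃ x, i = f x w})
      (t := {i | ∃ x y, y ≠ w ∧ i = f x y})]
    · have h1 := integral_cut_le r hf hp0 hr N (fun h => hb (hNR h))
      have h2 : Real.exp (-(p * N.card / 2)) = y ^ N.card := by
        rw [hy, ← Real.exp_nat_mul]
        congr 1
        ring
      have h3 : (N.card : ℝ) ≤ R.card := by exact_mod_cast Finset.card_le_card hNR
      have h4 : 4 * (N.card * Real.exp (-(p * N.card / 2))) ≤ 4 * R.card * y ^ N.card := by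
        rw [h2, mul_assoc]
        gcongr
      rw [integral_const_mul, integral_mul_const]
      have h5 : 0 ≤ ∫ ω, ind (O ω = N) ∂coinLaw r := integral_nonneg fun _ => ind_nonneg _
      nlinarith [mul_le_mul_of_nonneg_left (h1.trans h4) h5]
    · rw [Set.disjoint_left]
      rintro i ⟨x, rfl⟩ ⟨x', y', hy', h⟩
      exact hy' (hf h).2.symm
    · intro ω ω' h
      have : O ω = O ω' := Finset.filter_congr fun x _ => by rw [h _ ⟨x, rfl⟩]
      simp only [this]
    · intro ω ω' h
      have hne : ∀ y ∈ insert b N, y ≠ w := by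
        intro y hy
        rcases Finset.mem_insert.1 hy with rfl | hy
        · exact hbw
        · rintro rfl
          exact hw (hNR hy)
      refine congrArg ind (propext (exists_congr fun S => and_congr_right fun _ =>
        and_congr_right fun _ => forall₂_congr fun x _ => forall₂_congr fun y hy => ?_))
      rw [h _ ⟨x, y, hne y (Finset.mem_sdiff.1 hy).1, rfl⟩]
  have hprod : ∀ ω : ι → Bool, y ^ (O ω).card =
      ∏ x ∈ R, if ω (f x w) = true then y else 1 := by
    intro ω
    rw [Finset.prod_ite, Finset.prod_const, Finset.prod_const_one, mul_one]
  -- A coin is `true` with probability at least `p` and then saves at least `p / 4`; this is the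
  -- source of the exponent `p ^ 2 / 4`.
  have hfac : ∀ i, ∫ ω, (if ω i = true then y else 1) ∂coinLaw r ≤ Real.exp (-(p ^ 2 / 4)) := by
    intro i
    rw [integral_coin r i fun b => if b = true then y else 1]
    have h1 : y ≤ 1 - p / 2 / 2 := exp_neg_le_one_sub_half (by linarith) (by linarith)
    have h2 := Real.add_one_le_exp (-(p ^ 2 / 4))
    have h3 := hr i
    simp only [if_true, Bool.false_eq_true, if_false]
    nlinarith
  calc ∫ ω, ind (CutFail f R b w ω) ∂coinLaw r
      ≤ ∫ ω, ∑ N ∈ R.powerset, ind (O ω = N ∧ cut N ω) ∂coinLaw r := by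
        refine integral_mono_coins r fun ω => (ind_mono fun h => ?_).trans (ind_exists_le_sum _ _)
        exact ⟨O ω, Finset.mem_powerset.2 (Finset.filter_subset _ _), rfl, h⟩
    _ ≤ ∑ N ∈ R.powerset, ∫ ω, 4 * R.card * (ind (O ω = N) * y ^ N.card) ∂coinLaw r := by
        rw [integral_finsetSum _ fun _ _ => .of_finite]
        exact Finset.sum_le_sum hN
    _ = 4 * R.card * ∫ ω, ∑ N ∈ R.powerset, ind (O ω = N) * y ^ N.card ∂coinLaw r := by
        rw [integral_finsetSum _ fun _ _ => .of_finite, Finset.mul_sum]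
        simp only [integral_const_mul]
    _ = 4 * R.card * ∫ ω, ∏ x ∈ R, (if ω (f x w) = true then y else 1) ∂coinLaw r := by
        congr 2
        funext ω
        rw [← hprod, Finset.sum_eq_single (O ω)]
        · rw [ind_true rfl, one_mul]
        · intro N _ hne
          rw [ind_false (Ne.symm hne), zero_mul]
        · intro h
          exact absurd (Finset.mem_powerset.2 (Finset.filter_subset _ _)) h
    _ ≤ 4 * R.card * Real.exp (-(p ^ 2 / 4)) ^ R.card := by
        rw [integral_prod_of_dependsOn r R (fun x ω => if ω (f x w) = true then y else 1)
          (fun x => {f x w})]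
        · refine mul_le_mul_of_nonneg_left ?_ (by positivity)
          rw [← Finset.prod_const]
          refine Finset.prod_le_prod (fun x _ => integral_nonneg fun ω => ?_) fun x _ => hfac _
          simp only [Pi.zero_apply]
          split_ifs <;> positivity
        · intro i _ j _ hij
          rw [Set.disjoint_singleton]
          exact fun h => hij (hf h).1
        · intro x _ ω ω' h
          simp only [h _ rfl]

end Cut

/-! ### Growth of saturated intervals -/

section Saturation

variable {n : ℕ}

/-- All open edges inside `R` are eventually occupied. -/
def Saturated (ω : Config n) (R : Finset (Fin n)) : Prop :=
  ∀ x ∈ R, ∀ y ∈ R, (x, y) ∈ lineEdges n ∪ openEdges ω → (x, y) ∈ finalEdges ω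

/-- The saturation of `R` may fail to spread from `u ∈ R` to its neighbour `w`. -/
def StepFail (ω : Config n) (R : Finset (Fin n)) (u w : Fin n) : Prop :=
  CutFail (fun x y => (x, y)) (R.erase u) u w ω ∨ CutFail (fun x y => (y, x)) (R.erase u) u w ω

/-- The edges between `u` and `w` are occupied from the start. If `x → y` is open inside `R`, it is
occupied by saturation, so occupation of `y → w` passes to an open `x → w`. Occupation therefore
spreads backwards from `u`, and symmetrically for edges leaving `w`. -/
lemma Saturated.insert_vertex {ω : Config n} {R : Finset (Fin n)} (h : Saturated ω R) {u w : Fin n}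
    (hu : u ∈ R) (hw : w ∉ R) (huw : (u, w) ∈ lineEdges n) (hs : ¬ StepFail ω R u w) :
    Saturated ω (insert w R) := by
  have hwu : (w, u) ∈ lineEdges n := mem_lineEdges.2 (mem_lineEdges.1 huw).symm
  have hne : ∀ x ∈ R, x ≠ w := fun x hx hxw => hw (hxw ▸ hx)
  have hmem : ∀ {y}, y ∈ insert u (R.erase u) → y ∈ R := fun {y} hy => by
    rwa [Finset.insert_erase hu] at hy
  unfold StepFail at hs
  push Not at hs
  have hin : ∀ x ∈ R.erase u, ω (x, w) = true → (x, w) ∈ finalEdges ω := by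
    refine reaches_of_not_cutFail hs.1 (P := fun x => (x, w) ∈ finalEdges ω)
      (subset_eventuallyOccupied huw) fun x hx hxw y hy hxy hyw => ?_
    have hxR := Finset.mem_of_mem_erase hx
    -- The ignored coin of a self-loop may show `true`, in which case the step is vacuous.
    by_cases hxy' : x = y
    · rw [hxy']; exact hyw
    · exact eventuallyOccupied_join (mem_line_or_open (hne x hxR) hxw)
        (h x hxR y (hmem hy) (mem_line_or_open hxy' hxy)) hyw
  have hout : ∀ x ∈ R.erase u, ω (w, x) = true → (w, x) ∈ finalEdges ω := by
    refine reaches_of_not_cutFail hs.2 (P := fun x => (w, x) ∈ finalEdges ω)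
      (subset_eventuallyOccupied hwu) fun x hx hxw y hy hxy hyw => ?_
    have hxR := Finset.mem_of_mem_erase hx
    by_cases hxy' : y = x
    · rw [← hxy']; exact hyw
    · exact eventuallyOccupied_join (mem_line_or_open (hne x hxR).symm hxw) hyw
        (h y (hmem hy) x hxR (mem_line_or_open hxy' hxy))
  intro x hx y hy hxy
  rcases hxy with hxy | hxy
  · exact subset_eventuallyOccupied hxy
  rcases Finset.mem_insert.1 hx with rfl | hxR
  · rcases Finset.mem_insert.1 hy with rfl | hyR
    · exact absurd rfl hxy.2.1
    · by_cases hyu : y = u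
      · exact absurd (hyu ▸ hwu) hxy.1
      · exact hout y (Finset.mem_erase.2 ⟨hyu, hyR⟩) hxy.2.2
  · rcases Finset.mem_insert.1 hy with rfl | hyR
    · by_cases hxu : x = u
      · exact absurd (hxu ▸ huw) hxy.1
      · exact hin x (Finset.mem_erase.2 ⟨hxu, hxR⟩) hxy.2.2
    · exact h x hxR y hyR (Or.inr hxy)

/-- The vertices `x` with `a ≤ x < b`. -/
def seg (n a b : ℕ) : Finset (Fin n) := Finset.univ.filter fun x => a ≤ x.val ∧ x.val < b

lemma mem_seg {a b : ℕ} {x : Fin n} : x ∈ seg n a b ↔ a ≤ x.val ∧ x.val < b := by simp [seg]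

lemma card_seg {a b : ℕ} (hb : b ≤ n) : (seg n a b).card = b - a := by
  rw [← Nat.card_Ico a b, ← Finset.card_map Fin.valEmbedding]
  congr 1
  ext k
  simp only [Finset.mem_map, mem_seg, Fin.valEmbedding_apply, Finset.mem_Ico]
  constructor
  · rintro ⟨x, hx, rfl⟩
    exact hx
  · intro hk
    exact ⟨⟨k, by omega⟩, hk, rfl⟩

lemma insert_seg_right {a b : ℕ} {w : Fin n} (hw : w.val = b) (hab : a ≤ b) :
    insert w (seg n a b) = seg n a (b + 1) := by
  ext x
  simp only [Finset.mem_insert, mem_seg, Fin.ext_iff]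
  omega

lemma insert_seg_left {a b : ℕ} {w : Fin n} (hw : w.val = a) (hab : a < b) :
    insert w (seg n (a + 1) b) = seg n a b := by
  ext x
  simp only [Finset.mem_insert, mem_seg, Fin.ext_iff]
  omega

/-- The interval `a ≤ x < b` may fail to grow to the right. -/
def RightFail (ω : Config n) (a b : ℕ) : Prop :=
  ∃ u w : Fin n, u.val + 1 = b ∧ w.val = b ∧ StepFail ω (seg n a b) u w

/-- The interval `a ≤ x < b` may fail to grow to the left. -/
def LeftFail (ω : Config n) (a b : ℕ) : Prop :=
  ∃ u w : Fin n, u.val = a ∧ w.val + 1 = a ∧ StepFail ω (seg n a b) u w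

lemma Saturated.grow_right {ω : Config n} {a b c : ℕ} (h : Saturated ω (seg n a b)) (hab : a < b)
    (hbc : b ≤ c) (hc : c ≤ n) (hf : ∀ d, b ≤ d → d < c → ¬ RightFail ω a d) :
    Saturated ω (seg n a c) := by
  induction c, hbc using Nat.le_induction with
  | base => exact h
  | succ c hbc ih =>
    have ih := ih (by omega) fun d hd hdc => hf d hd (by omega)
    have hu : c - 1 < n := by omega
    rw [← insert_seg_right (w := ⟨c, hc⟩) (b := c) rfl (by omega)]
    refine ih.insert_vertex (u := ⟨c - 1, hu⟩) ?_ ?_ ?_ fun hs => hf c hbc (by omega)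
      ⟨⟨c - 1, hu⟩, ⟨c, hc⟩, ?_, rfl, hs⟩
    · rw [mem_seg]; simp only; omega
    · rw [mem_seg]; simp only; omega
    · rw [mem_lineEdges]; simp only; omega
    · simp only; omega

lemma Saturated.grow_left {ω : Config n} {a b : ℕ} (h : Saturated ω (seg n a b)) (hab : a < b)
    (hb : b ≤ n) (hf : ∀ d, 0 < d → d ≤ a → ¬ LeftFail ω d b) : Saturated ω (seg n 0 b) := by
  induction a with
  | zero => exact h
  | succ a ih =>
    refine ih ?_ (by omega) fun d hd hda => hf d hd (by omega)
    have hu : a + 1 < n := by omega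
    have hw : a < n := by omega
    rw [← insert_seg_left (w := ⟨a, hw⟩) (a := a) rfl (by omega)]
    refine h.insert_vertex (u := ⟨a + 1, hu⟩) ?_ ?_ ?_ fun hs => hf (a + 1) (by omega) le_rfl
      ⟨⟨a + 1, hu⟩, ⟨a, hw⟩, rfl, rfl, hs⟩
    · rw [mem_seg]; simp only; omega
    · rw [mem_seg]; simp only; omega
    · exact mem_lineEdges.2 (Or.inr rfl)

lemma finalEdges_eq_of_saturated {ω : Config n} (h : Saturated ω (seg n 0 n)) :
    finalEdges ω = lineEdges n ∪ openEdges ω := by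
  refine Set.Subset.antisymm eventuallyOccupied_subset fun e he => ?_
  exact h e.1 (mem_seg.2 ⟨Nat.zero_le _, e.1.2⟩) e.2 (mem_seg.2 ⟨Nat.zero_le _, e.2.2⟩) he

/-- The edges in both directions between `v` and the next `s` vertices. -/
def star (n v s : ℕ) : Finset (Fin n × Fin n) :=
  Finset.univ.filter fun e => (e.1.val = v ∧ v < e.2.val ∧ e.2.val ≤ v + s) ∨
    (e.2.val = v ∧ v < e.1.val ∧ e.1.val ≤ v + s)

lemma mem_star {v s : ℕ} {e : Fin n × Fin n} : e ∈ star n v s ↔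
    (e.1.val = v ∧ v < e.2.val ∧ e.2.val ≤ v + s) ∨
    (e.2.val = v ∧ v < e.1.val ∧ e.1.val ≤ v + s) := by simp [star]

lemma card_star_le (v s : ℕ) : (star n v s).card ≤ 2 * s := by
  by_cases hv : v < n
  · have hsub : star n v s ⊆ (seg n (v + 1) (v + s + 1)).image (fun x => (⟨v, hv⟩, x)) ∪
        (seg n (v + 1) (v + s + 1)).image (fun x => (x, ⟨v, hv⟩)) := by
      rintro ⟨x, y⟩ he
      simp only [mem_star, Finset.mem_union, Finset.mem_image, mem_seg, Prod.mk.injEq,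
        Fin.ext_iff] at he ⊢
      rcases he with he | he
      · exact Or.inl ⟨y, by omega, by omega, rfl⟩
      · exact Or.inr ⟨x, by omega, rfl, by omega⟩
    have hseg : (seg n (v + 1) (v + s + 1)).card ≤ s :=
      (card_filter_val_le _ _).trans (by omega)
    have h1 := (Finset.card_le_card hsub).trans (Finset.card_union_le _ _)
    have h2 := Finset.card_image_le (s := seg n (v + 1) (v + s + 1))
      (f := fun x => ((⟨v, hv⟩ : Fin n), x))
    have h3 := Finset.card_image_le (s := seg n (v + 1) (v + s + 1))
      (f := fun x => (x, (⟨v, hv⟩ : Fin n)))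
    omega
  · have : star n v s = ∅ := by
      refine Finset.eq_empty_of_forall_notMem fun e he => ?_
      rw [mem_star] at he
      omega
    simp [this]

/-- The star's edges become occupied one after another, each extended by a unit edge of the line.
Any other open edge of the interval is then a join through the centre. -/
lemma saturated_of_star {ω : Config n} {v s : ℕ} (hv : v + s < n)
    (h : ∀ e ∈ star n v s, ω e = true) : Saturated ω (seg n v (v + s + 1)) := by
  set c : Fin n := ⟨v, by omega⟩
  have hout : ∀ k, ∀ x : Fin n, x.val = v + 1 + k → k < s → (c, x) ∈ finalEdges ω ∧
      (x, c) ∈ finalEdges ω := by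
    intro k
    induction k with
    | zero =>
      intro x hx _
      constructor
      · exact subset_eventuallyOccupied (mem_lineEdges.2 (Or.inl hx.symm))
      · exact subset_eventuallyOccupied (mem_lineEdges.2 (Or.inr hx.symm))
    | succ k ih =>
      intro x hx hk
      have hy : v + 1 + k < n := by omega
      obtain ⟨h1, h2⟩ := ih ⟨v + 1 + k, hy⟩ rfl (by omega)
      have hcx : c ≠ x := fun h => by
        have := congrArg Fin.val h
        simp only [c] at this
        omega
      constructor
      · refine eventuallyOccupied_join (mem_line_or_open hcx (h _ (mem_star.2 (Or.inl
          ⟨rfl, by simp only; omega, by simp only; omega⟩)))) h1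
          (subset_eventuallyOccupied (mem_lineEdges.2 (Or.inl ?_)))
        simp only; omega
      · refine eventuallyOccupied_join (mem_line_or_open hcx.symm (h _ (mem_star.2 (Or.inr
          ⟨rfl, by simp only; omega, by simp only; omega⟩))))
          (subset_eventuallyOccupied (mem_lineEdges.2 (Or.inr ?_))) h2
        simp only; omega
  have hout' : ∀ x ∈ seg n v (v + s + 1), x ≠ c → (c, x) ∈ finalEdges ω ∧
      (x, c) ∈ finalEdges ω := by
    intro x hx hxc
    rw [mem_seg] at hx
    have : x.val ≠ v := fun h => hxc (Fin.ext h)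
    exact hout (x.val - (v + 1)) x (by omega) (by omega)
  intro x hx y hy hxy
  by_cases hxc : x = c
  · by_cases hyc : y = c
    · subst hxc
      rw [hyc] at hxy
      rcases hxy with hxy | hxy
      · exact subset_eventuallyOccupied (hyc ▸ hxy)
      · exact absurd rfl hxy.2.1
    · rw [hxc]; exact (hout' y hy hyc).1
  · by_cases hyc : y = c
    · rw [hyc]; exact (hout' x hx hxc).2
    · exact eventuallyOccupied_join hxy (hout' x hx hxc).2 (hout' y hy hyc).1

/-- The block of length `B` starting at `v` contains a nucleus that grows through the block. -/
def BlockGood (ω : Config n) (s B v : ℕ) : Prop :=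
  (∀ e ∈ star n v s, ω e = true) ∧ ∀ d ∈ Finset.Ico (v + s + 1) (v + B), ¬ RightFail ω v d

/-- The nucleus fills its block, then grows right to the end of the line, and finally left to `0`.
Outside the block only intervals of length at least `B` occur. -/
lemma finalEdges_eq_of_blockGood {ω : Config n} {s B v : ℕ} (hs : s + 1 ≤ B) (hv : v + B ≤ n)
    (h : BlockGood ω s B v)
    (hfar : ∀ a b, a + B ≤ b → b ≤ n → ¬ RightFail ω a b ∧ ¬ LeftFail ω a b) :
    finalEdges ω = lineEdges n ∪ openEdges ω := by
  have h1 := saturated_of_star (by omega) h.1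
  have h2 := h1.grow_right (c := v + B) (by omega) (by omega) hv
    fun d hd hdc => h.2 d (Finset.mem_Ico.2 ⟨hd, hdc⟩)
  have h3 := h2.grow_right (c := n) (by omega) hv le_rfl fun d hd hdc => (hfar v d hd hdc.le).1
  exact finalEdges_eq_of_saturated
    (h3.grow_left (by omega) le_rfl fun d _ hda => (hfar d n (by omega) le_rfl).2)

/-! ### Failure probabilities of growth steps, blocks and saturation -/

variable (r : Fin n × Fin n → unitInterval) {p : ℝ}

/-- The bound on the failure probability of a growth step of an interval of length `ℓ + 1`. -/
noncomputable def failBound (p : ℝ) (ℓ : ℕ) : ℝ := 8 * ℓ * Real.exp (-(p ^ 2 / 4)) ^ ℓ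

lemma failBound_nonneg (p : ℝ) (ℓ : ℕ) : 0 ≤ failBound p ℓ := by unfold failBound; positivity

lemma integral_stepFail_le (hp0 : 0 ≤ p) (hp1 : p ≤ 1) (hr : ∀ e, p ≤ r e) {R : Finset (Fin n)}
    {u w : Fin n} (hu : u ∈ R) (hw : w ∉ R) :
    ∫ ω, ind (StepFail ω R u w) ∂coinLaw r ≤ failBound p (R.card - 1) := by
  have hne : u ≠ w := fun h => hw (h ▸ hu)
  have h1 := integral_cutFail_le r (f := fun x y => (x, y)) (fun _ _ _ _ h => Prod.mk.inj h)
    hp0 hp1 hr (R.erase u) (Finset.notMem_erase u R) (fun h => hw (Finset.mem_of_mem_erase h)) hne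
  have h2 := integral_cutFail_le r (f := fun x y => (y, x)) (fun _ _ _ _ h => (Prod.mk.inj h).symm)
    hp0 hp1 hr (R.erase u) (Finset.notMem_erase u R) (fun h => hw (Finset.mem_of_mem_erase h)) hne
  rw [Finset.card_erase_of_mem hu] at h1 h2
  refine (integral_mono_coins r fun ω => ind_or_le _ _).trans ?_
  rw [integral_add .of_finite .of_finite, failBound]
  linarith

lemma integral_rightFail_le (hp0 : 0 ≤ p) (hp1 : p ≤ 1) (hr : ∀ e, p ≤ r e) {a b : ℕ}
    (hab : a < b) : ∫ ω, ind (RightFail ω a b) ∂coinLaw r ≤ failBound p (b - a - 1) := by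
  by_cases hb : b < n
  · have hu : b - 1 < n := by omega
    rw [← card_seg hb.le]
    refine (integral_mono_coins r fun ω => ind_mono ?_).trans
      (integral_stepFail_le r hp0 hp1 hr (R := seg n a b) (u := ⟨b - 1, hu⟩) (w := ⟨b, hb⟩) ?_ ?_)
    · rintro ⟨u, w, h1, h2, h⟩
      obtain rfl : u = ⟨b - 1, hu⟩ := Fin.ext (by simp only; omega)
      obtain rfl : w = ⟨b, hb⟩ := Fin.ext h2
      exact h
    · rw [mem_seg]; simp only; omega
    · rw [mem_seg]; simp only; omega
  · have : ∀ ω : Config n, ind (RightFail ω a b) = 0 := fun ω => ind_false <| by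
      rintro ⟨u, w, h1, h2, h⟩
      omega
    simp only [this, integral_zero]
    exact failBound_nonneg _ _

lemma integral_leftFail_le (hp0 : 0 ≤ p) (hp1 : p ≤ 1) (hr : ∀ e, p ≤ r e) {a b : ℕ}
    (hab : a < b) (hb : b ≤ n) :
    ∫ ω, ind (LeftFail ω a b) ∂coinLaw r ≤ failBound p (b - a - 1) := by
  by_cases ha : 0 < a
  · have hu : a < n := by omega
    have hw : a - 1 < n := by omega
    rw [← card_seg hb]
    refine (integral_mono_coins r fun ω => ind_mono ?_).trans
      (integral_stepFail_le r hp0 hp1 hr (R := seg n a b) (u := ⟨a, hu⟩) (w := ⟨a - 1, hw⟩) ?_ ?_)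
    · rintro ⟨u, w, h1, h2, h⟩
      obtain rfl : u = ⟨a, hu⟩ := Fin.ext h1
      obtain rfl : w = ⟨a - 1, hw⟩ := Fin.ext (by simp only; omega)
      exact h
    · rw [mem_seg]; simp only; omega
    · rw [mem_seg]; simp only; omega
  · have : ∀ ω : Config n, ind (LeftFail ω a b) = 0 := fun ω => ind_false <| by
      rintro ⟨u, w, h1, h2, h⟩
      omega
    simp only [this, integral_zero]
    exact failBound_nonneg _ _

lemma cutFail_congr {f : Fin n → Fin n → Fin n × Fin n} {R : Finset (Fin n)} {u w : Fin n}
    {ω ω' : Config n} (h : ∀ x ∈ insert w (insert u R), ∀ y ∈ insert w (insert u R),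
      ω (f x y) = ω' (f x y)) : CutFail f R u w ω ↔ CutFail f R u w ω' := by
  have hO : (R.filter fun x => ω (f x w) = true) = R.filter fun x => ω' (f x w) = true :=
    Finset.filter_congr fun x hx => by rw [h x (by simp [hx]) w (by simp)]
  unfold CutFail
  rw [hO]
  refine exists_congr fun S => and_congr_right fun hS => and_congr_right fun _ =>
    forall₂_congr fun x hx => forall₂_congr fun y hy => ?_
  have hxR : x ∈ R := (Finset.mem_filter.1 (hS hx)).1
  have hyR : y ∈ insert u R := by
    rcases Finset.mem_insert.1 (Finset.mem_sdiff.1 hy).1 with rfl | hy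
    · exact Finset.mem_insert_self _ _
    · exact Finset.mem_insert_of_mem (Finset.mem_filter.1 hy).1
  rw [h x (by simp [hxR]) y (Finset.mem_insert_of_mem hyR)]

/-- The last growth step, with `d = v + B - 1`, adds the last vertex of the block, so no coin
outside the block is read. Disjoint blocks are therefore independent. -/
lemma dependsOn_blockGood {s B v : ℕ} (hs : s + 1 ≤ B) :
    DependsOn (fun ω : Config n => ind (¬ BlockGood ω s B v))
      {e | (v ≤ e.1.val ∧ e.1.val < v + B) ∧ v ≤ e.2.val ∧ e.2.val < v + B} := by
  intro ω ω' h
  refine congrArg (fun P => ind (¬ P)) (propext (and_congr ?_ ?_))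
  · refine forall₂_congr fun e he => ?_
    rw [h e]
    rw [mem_star] at he
    simp only [Set.mem_ofPred_eq]
    omega
  · refine forall₂_congr fun d hd => not_congr ?_
    rw [Finset.mem_Ico] at hd
    refine exists_congr fun u => exists_congr fun w => and_congr_right fun hu =>
      and_congr_right fun hw => ?_
    have hmem : ∀ x ∈ insert w (insert u ((seg n v d).erase u)), v ≤ x.val ∧ x.val < v + B := by
      intro x hx
      simp only [Finset.mem_insert, Finset.mem_erase, mem_seg] at hx
      rcases hx with rfl | rfl | hx <;> omega
    refine or_congr (cutFail_congr fun x hx y hy => h _ ⟨hmem x hx, hmem y hy⟩)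
      (cutFail_congr fun x hx y hy => h _ ⟨hmem y hy, hmem x hx⟩)

/-- Conditioning on the star only raises some biases to 1, so the lower bound `p` persists and the
growth estimates apply unchanged. Given the star, growth succeeds with probability at least 1/2. -/
lemma integral_not_blockGood_le (hp0 : 0 ≤ p) (hp1 : p ≤ 1) (hr : ∀ e, p ≤ r e) {s B v : ℕ}
    (hsum : ∑ ℓ ∈ Finset.Ico s B, failBound p ℓ ≤ 1 / 2) :
    ∫ ω, ind (¬ BlockGood ω s B v) ∂coinLaw r ≤ 1 - p ^ (2 * s) / 2 := by
  set r' : Fin n × Fin n → unitInterval := fun e => if e ∈ star n v s then 1 else r e with hr'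
  have hr'p : ∀ e, p ≤ r' e := by
    intro e
    simp only [hr']
    split_ifs
    · exact hp1
    · exact hr e
  have hloc : 1 / 2 ≤ ∫ ω, ind (∀ d ∈ Finset.Ico (v + s + 1) (v + B), ¬ RightFail ω v d)
      ∂coinLaw r' := by
    have h1 : ∫ ω, ind (∃ d ∈ Finset.Ico (v + s + 1) (v + B), RightFail ω v d) ∂coinLaw r' ≤
        1 / 2 := by
      refine (integral_mono_coins r' fun ω => ind_exists_le_sum _ _).trans ?_
      rw [integral_finsetSum _ fun _ _ => .of_finite]
      refine (Finset.sum_le_sum fun d hd => integral_rightFail_le r' hp0 hp1 hr'p ?_).trans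
        (le_trans ?_ hsum)
      · rw [Finset.mem_Ico] at hd
        omega
      · have hinj : Set.InjOn (fun d => d - v - 1) (Finset.Ico (v + s + 1) (v + B) : Set ℕ) := by
          intro x hx y hy hxy
          simp only [Finset.coe_Ico, Set.mem_Ico] at hx hy hxy
          omega
        rw [← Finset.sum_image hinj]
        refine Finset.sum_le_sum_of_subset_of_nonneg ?_ fun _ _ _ => failBound_nonneg _ _
        intro ℓ hℓ
        simp only [Finset.mem_image, Finset.mem_Ico] at hℓ ⊢
        omega
    have h2 : ∀ ω : Config n, ind (∀ d ∈ Finset.Ico (v + s + 1) (v + B), ¬ RightFail ω v d) =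
        1 - ind (∃ d ∈ Finset.Ico (v + s + 1) (v + B), RightFail ω v d) := by
      intro ω
      rw [← ind_not]
      push Not
      rfl
    simp only [h2]
    rw [integral_sub .of_finite .of_finite]
    simp only [integral_const, probReal_univ, one_smul]
    linarith
  have hprod : p ^ (2 * s) ≤ ∏ e ∈ star n v s, (r e : ℝ) := by
    calc p ^ (2 * s) ≤ p ^ (star n v s).card := pow_le_pow_of_le_one hp0 hp1 (card_star_le v s)
      _ = ∏ e ∈ star n v s, p := (Finset.prod_const p).symm
      _ ≤ _ := Finset.prod_le_prod (fun _ _ => hp0) fun e _ => hr e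
  have hgood : p ^ (2 * s) / 2 ≤ ∫ ω, ind (BlockGood ω s B v) ∂coinLaw r := by
    simp only [BlockGood, ind_and]
    rw [integral_ind_forall_mul r (star n v s) fun ω =>
      ind (∀ d ∈ Finset.Ico (v + s + 1) (v + B), ¬ RightFail ω v d)]
    have h0 : 0 ≤ p ^ (2 * s) := by positivity
    calc p ^ (2 * s) / 2 = p ^ (2 * s) * (1 / 2) := by ring
      _ ≤ _ := mul_le_mul hprod hloc (by norm_num) (h0.trans hprod)
  simp only [ind_not]
  rw [integral_sub .of_finite .of_finite]
  simp only [integral_const, probReal_univ, one_smul]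
  linarith

lemma integral_far_fail_le (hp0 : 0 ≤ p) (hp1 : p ≤ 1) (hr : ∀ e, p ≤ r e) {B : ℕ} (hB : 1 ≤ B) :
    ∫ ω, ind (∃ a b, a + B ≤ b ∧ b ≤ n ∧ (RightFail ω a b ∨ LeftFail ω a b)) ∂coinLaw r ≤
      n * (n + 1) * (16 * n * Real.exp (-(p ^ 2 / 4)) ^ (B - 1)) := by
  set t := Real.exp (-(p ^ 2 / 4)) with ht
  have ht1 : t ≤ 1 := Real.exp_le_one_iff.2 (by nlinarith [sq_nonneg p])
  have ht0 : 0 ≤ t := (Real.exp_pos _).le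
  have hone : ∀ e ∈ Finset.range n ×ˢ Finset.range (n + 1),
      ∫ ω, ind (e.1 + B ≤ e.2 ∧ e.2 ≤ n ∧ (RightFail ω e.1 e.2 ∨ LeftFail ω e.1 e.2)) ∂coinLaw r ≤
      16 * n * t ^ (B - 1) := by
    rintro ⟨a, b⟩ -
    by_cases h : a + B ≤ b ∧ b ≤ n
    · have h1 := integral_rightFail_le r hp0 hp1 hr (a := a) (b := b) (by omega)
      have h2 := integral_leftFail_le r hp0 hp1 hr (a := a) (b := b) (by omega) h.2
      have h3 : failBound p (b - a - 1) ≤ 8 * n * t ^ (B - 1) := by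
        unfold failBound
        have : ((b - a - 1 : ℕ) : ℝ) ≤ n := by exact_mod_cast (by omega : b - a - 1 ≤ n)
        have h4 : t ^ (b - a - 1) ≤ t ^ (B - 1) := pow_le_pow_of_le_one ht0 ht1 (by omega)
        gcongr
      refine (integral_mono_coins r fun ω => (ind_mono fun hω => hω.2.2).trans
        (ind_or_le _ _)).trans ?_
      rw [integral_add .of_finite .of_finite]
      linarith
    · have : ∀ ω : Config n, ind (a + B ≤ b ∧ b ≤ n ∧ (RightFail ω a b ∨ LeftFail ω a b)) = 0 :=
        fun ω => ind_false fun hω => h ⟨hω.1, hω.2.1⟩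
      simp only [this, integral_zero]
      positivity
  calc _ ≤ ∫ ω, ∑ e ∈ Finset.range n ×ˢ Finset.range (n + 1),
          ind (e.1 + B ≤ e.2 ∧ e.2 ≤ n ∧ (RightFail ω e.1 e.2 ∨ LeftFail ω e.1 e.2))
          ∂coinLaw r := by
        refine integral_mono_coins r fun ω => (ind_mono ?_).trans (ind_exists_le_sum _ _)
        rintro ⟨a, b, h1, h2, h3⟩
        refine ⟨(a, b), ?_, h1, h2, h3⟩
        simp only [Finset.mem_product, Finset.mem_range]
        omega
    _ ≤ ∑ _e ∈ Finset.range n ×ˢ Finset.range (n + 1), 16 * n * t ^ (B - 1) := by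
        rw [integral_finsetSum _ fun _ _ => .of_finite]
        exact Finset.sum_le_sum hone
    _ = _ := by
        rw [Finset.sum_const, Finset.card_product, Finset.card_range, Finset.card_range,
          nsmul_eq_mul]
        push_cast
        ring

/-- The probability that saturation fails. -/
lemma integral_not_saturated_le (hp0 : 0 ≤ p) (hp1 : p ≤ 1) (hr : ∀ e, p ≤ r e) {s B : ℕ}
    (hs : s + 1 ≤ B) (hB : B * B ≤ n)
    (hsum : ∑ ℓ ∈ Finset.Ico s B, failBound p ℓ ≤ 1 / 2) :
    ∫ ω, ind (finalEdges ω ≠ lineEdges n ∪ openEdges ω) ∂coinLaw r ≤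
      (1 - p ^ (2 * s) / 2) ^ B +
        n * (n + 1) * (16 * n * Real.exp (-(p ^ 2 / 4)) ^ (B - 1)) := by
  have h1 : ∫ ω, ind (∀ i ∈ Finset.range B, ¬ BlockGood ω s B (i * B)) ∂coinLaw r ≤
      (1 - p ^ (2 * s) / 2) ^ B := by
    have := integral_forall_le_pow r (Finset.range B)
      (P := fun i ω => ¬ BlockGood ω s B (i * B))
      (s := fun i => {e | (i * B ≤ e.1.val ∧ e.1.val < i * B + B) ∧
        i * B ≤ e.2.val ∧ e.2.val < i * B + B}) (δ := 1 - p ^ (2 * s) / 2) ?_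
      (fun i _ => dependsOn_blockGood hs)
      (fun i _ => integral_not_blockGood_le r hp0 hp1 hr hsum)
    · rwa [Finset.card_range] at this
    · intro i _ j _ hij
      rw [Set.disjoint_left]
      rintro e ⟨⟨h1, h2⟩, -⟩ ⟨⟨h3, h4⟩, -⟩
      rcases lt_or_gt_of_ne hij with h | h
      · have : (i + 1) * B ≤ j * B := Nat.mul_le_mul_right B h
        rw [add_mul] at this
        omega
      · have : (j + 1) * B ≤ i * B := Nat.mul_le_mul_right B h
        rw [add_mul] at this
        omega
  refine le_trans ?_ (add_le_add h1 (integral_far_fail_le r hp0 hp1 hr (B := B) (by omega)))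
  rw [← integral_add .of_finite .of_finite]
  refine integral_mono_coins r fun ω => (ind_mono fun hω => ?_).trans (ind_or_le _ _)
  by_contra hcon
  push Not at hcon
  obtain ⟨⟨i, hi, hgood⟩, hfar⟩ := hcon
  refine hω (finalEdges_eq_of_blockGood hs ?_ hgood hfar)
  have : (i + 1) * B ≤ B * B := Nat.mul_le_mul_right B (Finset.mem_range.1 hi)
  rw [add_mul] at this
  omega

end Saturation

/-! ### Asymptotics -/

lemma tendsto_log_natCast : Tendsto (fun n : ℕ => Real.log n) atTop atTop :=
  Real.tendsto_log_atTop.comp tendsto_natCast_atTop_atTop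

/-- The base `exp (-(4 / α))` is chosen so that the power `α log n` gives `n ^ (-4)`, and half of it
`n ^ (-2)`. Rounding costs the constant factor. These rates beat the union bounds over `n ^ 2` edges
and over `n` intervals, respectively. -/
lemma exp_pow_floor_le {α : ℝ} (hα : 0 < α) {n : ℕ} (hn : 1 ≤ n) :
    Real.exp (-(4 / α)) ^ ⌊α * Real.log n⌋₊ ≤ Real.exp (4 / α) * ((n : ℝ) ^ 4)⁻¹ := by
  have hn0 : (0 : ℝ) < n := by exact_mod_cast hn
  have hX := Nat.lt_floor_add_one (α * Real.log n)
  have h4 : (0 : ℝ) < 4 / α := by positivity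
  rw [← Real.exp_log (inv_pos.2 (pow_pos hn0 4)), Real.log_inv, Real.log_pow, ← Real.exp_add,
    ← Real.exp_nat_mul, Real.exp_le_exp]
  have : 4 / α * (α * Real.log n) = 4 * Real.log n := by field_simp
  push_cast
  nlinarith

lemma exp_pow_half_floor_le {α : ℝ} (hα : 0 < α) {n : ℕ} (hn : 1 ≤ n) :
    Real.exp (-(4 / α)) ^ (⌊α * Real.log n⌋₊ / 2) ≤ Real.exp (4 / α) * ((n : ℝ) ^ 2)⁻¹ := by
  have hn0 : (0 : ℝ) < n := by exact_mod_cast hn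
  have hX := Nat.lt_floor_add_one (α * Real.log n)
  have hY : ((⌊α * Real.log n⌋₊ : ℕ) : ℝ) ≤ 2 * (⌊α * Real.log n⌋₊ / 2 : ℕ) + 1 := by
    exact_mod_cast (by omega : ⌊α * Real.log n⌋₊ ≤ 2 * (⌊α * Real.log n⌋₊ / 2) + 1)
  have h4 : (0 : ℝ) < 4 / α := by positivity
  rw [← Real.exp_log (inv_pos.2 (pow_pos hn0 2)), Real.log_inv, Real.log_pow, ← Real.exp_add,
    ← Real.exp_nat_mul, Real.exp_le_exp]
  have : 4 / α * (α * Real.log n) = 4 * Real.log n := by field_simp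
  push_cast
  nlinarith

/-- The constant `c` such that long edges do not appear at densities below `c / √(log n)`. -/
noncomputable def lowConst (α : ℝ) : ℝ := Real.exp (-(4 / α)) / 2 / (2 * (α + 1))

lemma lowConst_pos {α : ℝ} (hα : 0 < α) : 0 < lowConst α := by unfold lowConst; positivity

lemma eventually_low_density {α : ℝ} (hα : 0 < α) : ∀ᶠ n : ℕ in atTop,
    1 ≤ n ∧ 1 ≤ ⌊α * Real.log n⌋₊ ∧ 0 ≤ lowConst α * (1 / √(Real.log n)) ∧
      lowConst α * (1 / √(Real.log n)) +
        (2 * ⌊α * Real.log n⌋₊ : ℕ) * (lowConst α * (1 / √(Real.log n))) ^ 2 ≤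
          (Real.exp (-(4 / α)) / 2) ^ 2 := by
  set η := Real.exp (-(4 / α)) / 2 with hη
  have hη0 : 0 < η := by positivity
  have hc0 := lowConst_pos hα
  have hlim : Tendsto (fun n : ℕ => lowConst α * (1 / √(Real.log n))) atTop (𝓝 0) := by
    have h1 := (Real.tendsto_sqrt_atTop.comp tendsto_log_natCast).inv_tendsto_atTop.const_mul
      (lowConst α)
    simpa [Function.comp_def] using h1
  filter_upwards [eventually_ge_atTop 1, tendsto_log_natCast.eventually_ge_atTop (1 / α),
    tendsto_log_natCast.eventually_gt_atTop 0,
    hlim.eventually_le_const (show (0 : ℝ) < η ^ 2 / 2 by positivity)] with n hn h1 h0 hp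
  refine ⟨hn, Nat.one_le_floor_iff _ |>.2 ?_, by positivity, ?_⟩
  · rw [div_le_iff₀ hα] at h1
    linarith
  · have hX : ((⌊α * Real.log n⌋₊ : ℕ) : ℝ) ≤ α * Real.log n := Nat.floor_le (by positivity)
    have hsq : (lowConst α * (1 / √(Real.log n))) ^ 2 = lowConst α ^ 2 / Real.log n := by
      rw [mul_pow, div_pow, Real.sq_sqrt h0.le]
      ring
    -- The denominator `2 * (α + 1)` in `lowConst` serves this: `η ^ 2 = 4 * (α + 1) ^ 2 * lowConst
    -- α ^ 2` and `(α + 1) ^ 2 ≥ α`.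
    have hc2 : 2 * α * lowConst α ^ 2 ≤ η ^ 2 / 2 := by
      have : lowConst α * (2 * (α + 1)) = η := by
        unfold lowConst
        rw [← hη]
        field_simp
      rw [← this]
      nlinarith [sq_nonneg (lowConst α), sq_nonneg (lowConst α * α)]
    have h2 : ((2 * ⌊α * Real.log n⌋₊ : ℕ) : ℝ) * (lowConst α ^ 2 / Real.log n) ≤
        2 * α * lowConst α ^ 2 := by
      push_cast
      calc 2 * ((⌊α * Real.log n⌋₊ : ℕ) : ℝ) * (lowConst α ^ 2 / Real.log n)
          ≤ 2 * (α * Real.log n) * (lowConst α ^ 2 / Real.log n) := by gcongr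
        _ = 2 * α * lowConst α ^ 2 := by field_simp
    rw [hsq]
    linarith

lemma edgeProb_of_leftward {n : ℕ} {pl pr : unitInterval} {e : Fin n × Fin n} (h : e.2 < e.1) :
    edgeProb pl pr e = pl := if_neg h.not_gt

lemma edgeProb_of_rightward {n : ℕ} {pl pr : unitInterval} {e : Fin n × Fin n} (h : e.1 < e.2) :
    edgeProb pl pr e = pr := if_pos h

lemma natCast_mul_inv_sq {n : ℕ} (hn : 1 ≤ n) {K : ℝ} :
    (n : ℝ) * (K * ((n : ℝ) ^ 2)⁻¹) = K * (n : ℝ)⁻¹ := by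
  have : (n : ℝ) ≠ 0 := by exact_mod_cast (by omega : n ≠ 0)
  field_simp

lemma eventually_no_long_leftward {α : ℝ} (hα : 0 < α) {pleft pright : ℕ → unitInterval}
    (h : ∀ᶠ n : ℕ in atTop, (pleft n : ℝ) < lowConst α * (1 / √(Real.log n))) :
    ∀ᶠ n : ℕ in atTop, ∫ ω, ind (∃ e ∈ finalEdges ω, IsLeftward e ∧
      ⌊α * Real.log n⌋₊ < edgeLength e) ∂coinLaw (edgeProb (n := n) (pleft n) (pright n)) ≤
      Real.exp (4 / α) * (n : ℝ)⁻¹ := by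
  filter_upwards [h, eventually_low_density hα] with n hp ⟨hn, hX, hp0, hη⟩
  have hle : Real.exp (-(4 / α)) ≤ 1 := Real.exp_le_one_iff.2 (by
    have : 0 < 4 / α := by positivity
    linarith)
  refine (integral_long_leftward_le _ (fun e he => ?_) hp0 (η := Real.exp (-(4 / α)) / 2)
    (by positivity) (by linarith) hX hη).trans ?_
  · rw [edgeProb_of_leftward he]
    exact hp.le
  · rw [← natCast_mul_inv_sq hn, mul_div_cancel₀ _ (two_ne_zero' ℝ)]
    gcongr
    exact exp_pow_half_floor_le hα hn

lemma eventually_no_long_rightward {α : ℝ} (hα : 0 < α) {pleft pright : ℕ → unitInterval}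
    (h : ∀ᶠ n : ℕ in atTop, (pright n : ℝ) < lowConst α * (1 / √(Real.log n))) :
    ∀ᶠ n : ℕ in atTop, ∫ ω, ind (∃ e ∈ finalEdges ω, IsRightward e ∧
      ⌊α * Real.log n⌋₊ < edgeLength e) ∂coinLaw (edgeProb (n := n) (pleft n) (pright n)) ≤
      Real.exp (4 / α) * (n : ℝ)⁻¹ := by
  filter_upwards [h, eventually_low_density hα] with n hp ⟨hn, hX, hp0, hη⟩
  have hle : Real.exp (-(4 / α)) ≤ 1 := Real.exp_le_one_iff.2 (by
    have : 0 < 4 / α := by positivity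
    linarith)
  refine (integral_long_rightward_le _ (fun e he => ?_) hp0 (η := Real.exp (-(4 / α)) / 2)
    (by positivity) (by linarith) hX hη).trans ?_
  · rw [edgeProb_of_rightward he]
    exact hp.le
  · rw [← natCast_mul_inv_sq hn, mul_div_cancel₀ _ (two_ne_zero' ℝ)]
    gcongr
    exact exp_pow_half_floor_le hα hn

lemma eventually_rightward_filled {α : ℝ} (hα : 0 < α) {pleft pright : ℕ → unitInterval}
    (h : ∀ᶠ n : ℕ in atTop, 1 - (Real.exp (-(4 / α)) / 6) ^ 2 < (pright n : ℝ)) :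
    ∀ᶠ n : ℕ in atTop, ∫ ω, ind (∃ e ∈ openEdges ω, IsRightward e ∧
      ⌊α * Real.log n⌋₊ < edgeLength e ∧ e ∉ finalEdges ω)
        ∂coinLaw (edgeProb (n := n) (pleft n) (pright n)) ≤
      2 * Real.exp (4 / α) * (n : ℝ)⁻¹ := by
  filter_upwards [h, eventually_ge_atTop 1] with n hp hn
  have hle : Real.exp (-(4 / α)) ≤ 1 := Real.exp_le_one_iff.2 (by
    have : 0 < 4 / α := by positivity
    linarith)
  refine (integral_unfilled_le _ (s := Real.exp (-(4 / α)) / 6) (by positivity) (by linarith)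
    (fun e he => ?_) _).trans ?_
  · rw [edgeProb_of_rightward he]
    linarith
  · have h6 : 6 * (Real.exp (-(4 / α)) / 6) = Real.exp (-(4 / α)) := by ring
    rw [h6]
    have hn1 : (1 : ℝ) ≤ n := by exact_mod_cast hn
    calc (n : ℝ) ^ 2 * (2 * Real.exp (-(4 / α)) ^ ⌊α * Real.log n⌋₊)
        ≤ (n : ℝ) ^ 2 * (2 * (Real.exp (4 / α) * ((n : ℝ) ^ 4)⁻¹)) := by
          gcongr
          exact exp_pow_floor_le hα hn
      _ = 2 * Real.exp (4 / α) * ((n : ℝ) ^ 2)⁻¹ := by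
          field_simp
      _ ≤ 2 * Real.exp (4 / α) * (n : ℝ)⁻¹ := by
          gcongr
          nlinarith

/-- The growth steps of a nucleus are unlikely to fail. -/
lemma sum_failBound_le {p : ℝ} (hp0 : 0 < p) (hp1 : p ≤ 1) (s B : ℕ) :
    ∑ ℓ ∈ Finset.Ico s B, failBound p ℓ ≤ 16 / (p ^ 2 / 8) ^ 2 * Real.exp (-(p ^ 2 / 8 * s)) := by
  set κ := p ^ 2 / 8 with hκ
  have hκ0 : 0 < κ := by positivity
  have hκ1 : κ ≤ 1 := by nlinarith
  set x := Real.exp (-κ) with hx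
  have hx0 : 0 < x := Real.exp_pos _
  have hx1 : x ≤ 1 - κ / 2 := exp_neg_le_one_sub_half hκ0.le hκ1
  -- Since `p ^ 2 / 4 = 2 * κ`, half of the exponential decay absorbs the factor `ℓ` and the other
  -- half remains summable.
  have hterm : ∀ ℓ, failBound p ℓ ≤ 8 / κ * x ^ ℓ := by
    intro ℓ
    have h1 : κ * ℓ * x ^ ℓ ≤ 1 := by
      rw [hx, ← Real.exp_nat_mul, mul_neg, Real.exp_neg, ← div_eq_mul_inv,
        div_le_one (Real.exp_pos _), mul_comm (ℓ : ℝ)]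
      linarith [Real.add_one_le_exp (κ * ℓ)]
    have h2 : Real.exp (-(p ^ 2 / 4)) ^ ℓ = x ^ ℓ * x ^ ℓ := by
      rw [← mul_pow, hx, ← Real.exp_add]
      congr 2
      rw [hκ]; ring
    unfold failBound
    rw [h2, div_mul_eq_mul_div, le_div_iff₀ hκ0]
    have h3 : 0 ≤ x ^ ℓ := by positivity
    nlinarith
  have hgeo : ∑ ℓ ∈ Finset.Ico s B, x ^ ℓ ≤ x ^ s * (2 / κ) := by
    have h1 : ∑ ℓ ∈ Finset.Ico s B, x ^ ℓ ≤ x ^ s / (1 - x) :=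
      geom_sum_Ico_le_of_lt_one hx0.le (by linarith)
    refine h1.trans ?_
    rw [div_eq_mul_inv]
    gcongr
    rw [inv_le_comm₀ (by linarith) (by positivity), inv_div]
    linarith
  calc ∑ ℓ ∈ Finset.Ico s B, failBound p ℓ ≤ ∑ ℓ ∈ Finset.Ico s B, 8 / κ * x ^ ℓ :=
        Finset.sum_le_sum fun ℓ _ => hterm ℓ
    _ ≤ 8 / κ * (x ^ s * (2 / κ)) := by
        rw [← Finset.mul_sum]
        gcongr
    _ = 16 / κ ^ 2 * Real.exp (-(κ * s)) := by
        rw [hx, ← Real.exp_nat_mul, show (s : ℝ) * -κ = -(κ * s) by ring]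
        field_simp
        norm_num

/-- The nucleus size must satisfy two opposing demands: `p ^ 2 * s` of order at least `log log n`,
so that growth succeeds, and `p ^ (2 * s)` well above `n ^ (-1/2)`, so that some block has a
nucleus. The choice `s ≈ lam / (4 * mu)` meets both for `p = 20 * mu / √lam`. -/
lemma integral_not_saturated_le_exp {n : ℕ} (r : Fin n × Fin n → unitInterval)
    {lam mu p : ℝ} (hlam : lam = Real.log n) (hmu : mu = Real.log lam) (hp : p = 20 * (mu / √lam))
    (hr : ∀ e, p ≤ r e) (hp1 : p ≤ 1) (hmu1 : 1 ≤ mu) (hmu2 : 50 * mu ^ 2 ≤ lam)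
    (hlam32 : 32 ≤ lam) (hbig : 4 * lam ^ 2 + 2 ≤ Real.exp (lam / 2)) :
    ∫ ω, ind (finalEdges ω ≠ lineEdges n ∪ openEdges ω) ∂coinLaw r ≤
      4 * Real.exp (-(lam / 4)) + 32 * Real.exp (-lam) := by
  have hlam0 : 0 < lam := by linarith
  have hmu0 : 0 < mu := by linarith
  have hn0 : (0 : ℝ) < n := by
    rcases Nat.eq_zero_or_pos n with rfl | h
    · simp at hlam
      linarith
    · exact_mod_cast h
  have hn : (n : ℝ) = Real.exp lam := by rw [hlam, Real.exp_log hn0]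
  have hexpmu : Real.exp mu = lam := by rw [hmu, Real.exp_log hlam0]
  have hp0 : 0 < p := by rw [hp]; positivity
  have hp2 : p ^ 2 = 400 * mu ^ 2 / lam := by
    rw [hp, mul_pow, div_pow, Real.sq_sqrt hlam0.le]
    ring
  have hp8 : 8 * (1 / lam) ≤ p ^ 2 := by
    rw [hp2, mul_one_div]
    gcongr
    nlinarith
  set s := ⌊lam / (4 * mu)⌋₊ with hs
  set B := Nat.sqrt n with hB
  have hs1 : (s : ℝ) ≤ lam / (4 * mu) := Nat.floor_le (by positivity)
  have hs2 : lam / (4 * mu) < s + 1 := Nat.lt_floor_add_one _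
  have hsl : (s : ℝ) ≤ lam := hs1.trans (div_le_self hlam0.le (by linarith))
  have hB1 : Real.exp (lam / 2) ≤ B + 1 := by
    rw [Real.exp_half, ← hn]
    rw [Real.sqrt_le_left (by positivity)]
    exact_mod_cast (Nat.lt_succ_sqrt' n).le
  have hBl : 4 * lam ^ 2 + 1 ≤ B := by linarith
  have hsB : s + 1 ≤ B := by
    have : (s : ℝ) + 1 ≤ B := by nlinarith
    exact_mod_cast this
  -- The product is about `25 / 2 * mu`, less at most 1 for rounding. Only `3 * mu` is needed: it
  -- gives `lam ^ (-3)` against the prefactor `16 * lam ^ 2`.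
  have hκs : 3 * mu ≤ p ^ 2 / 8 * s := by
    rw [hp2]
    have h1 : 400 * mu ^ 2 / lam / 8 * (lam / (4 * mu) - 1) ≤ 400 * mu ^ 2 / lam / 8 * s := by
      gcongr
      linarith
    have h2 : 400 * mu ^ 2 / lam / 8 * (lam / (4 * mu) - 1) = 25 / 2 * mu - 50 * mu ^ 2 / lam := by
      field_simp
      ring
    have h3 : 50 * mu ^ 2 / lam ≤ 1 := (div_le_one hlam0).2 hmu2
    linarith
  have hsum : ∑ ℓ ∈ Finset.Ico s B, failBound p ℓ ≤ 1 / 2 := by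
    refine (sum_failBound_le hp0 hp1 s B).trans ?_
    have h1 : 16 / (p ^ 2 / 8) ^ 2 ≤ 16 * lam ^ 2 := by
      have h2 : 1 / lam ≤ p ^ 2 / 8 := by linarith
      calc 16 / (p ^ 2 / 8) ^ 2 ≤ 16 / (1 / lam) ^ 2 := by gcongr
        _ = 16 * lam ^ 2 := by field_simp
    have h2 : Real.exp (-(p ^ 2 / 8 * s)) ≤ (lam ^ 3)⁻¹ := by
      calc Real.exp (-(p ^ 2 / 8 * s)) ≤ Real.exp (-(3 * mu)) := by gcongr
        _ = (lam ^ 3)⁻¹ := by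
          rw [Real.exp_neg, ← hexpmu, ← Real.exp_nat_mul]
          norm_num
    calc _ ≤ 16 * lam ^ 2 * (lam ^ 3)⁻¹ := by gcongr
      _ = 16 / lam := by field_simp
      _ ≤ 1 / 2 := by rw [div_le_div_iff₀ hlam0 (by norm_num)]; linarith
  refine (integral_not_saturated_le r hp0.le hp1 hr hsB (Nat.sqrt_le n) hsum).trans ?_
  gcongr ?_ + ?_
  -- A nucleus has probability at least `n ^ (-1/4)`, while there are about `n ^ (1/2)` blocks.
  · have hstar : Real.exp (-(lam / 4)) ≤ p ^ (2 * s) := by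
      have h1 : Real.exp (-mu) ≤ p ^ 2 := by
        rw [Real.exp_neg, hexpmu, hp2, inv_eq_one_div]
        gcongr
        nlinarith
      calc Real.exp (-(lam / 4)) ≤ Real.exp (-mu) ^ s := by
            rw [← Real.exp_nat_mul, Real.exp_le_exp]
            rw [le_div_iff₀ (by positivity)] at hs1
            linarith
        _ ≤ (p ^ 2) ^ s := by gcongr
        _ = p ^ (2 * s) := (pow_mul p 2 s).symm
    have hpow1 : p ^ (2 * s) ≤ 1 := pow_le_one₀ hp0.le hp1
    have hBhalf : Real.exp (lam / 2) / 2 ≤ B := by nlinarith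
    set y := Real.exp (lam / 4) with hy
    have hy0 : 0 < y := Real.exp_pos _
    have hyy : Real.exp (lam / 2) = y * y := by rw [hy, ← Real.exp_add]; ring_nf
    have hyi : Real.exp (-(lam / 4)) = y⁻¹ := Real.exp_neg _
    rw [hyi] at hstar ⊢
    rw [hyy] at hBhalf
    calc (1 - p ^ (2 * s) / 2) ^ B ≤ Real.exp (-(y⁻¹ / 2)) ^ B := by
          refine pow_le_pow_left₀ (by linarith) ?_ B
          linarith [Real.add_one_le_exp (-(y⁻¹ / 2))]
      _ = (Real.exp (B * (y⁻¹ / 2)))⁻¹ := by rw [← Real.exp_nat_mul, mul_neg, Real.exp_neg]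
      _ ≤ (y / 4)⁻¹ := by
          refine inv_anti₀ (by positivity) ?_
          have h1 : y / 4 ≤ B * (y⁻¹ / 2) := by
            calc y / 4 = y * y / 2 * (y⁻¹ / 2) := by field_simp; norm_num
              _ ≤ B * (y⁻¹ / 2) := by gcongr
          linarith [Real.add_one_le_exp (B * (y⁻¹ / 2))]
      _ = 4 * y⁻¹ := by rw [inv_div]; rfl
  · have hB' : ((B - 1 : ℕ) : ℝ) = B - 1 := by
      rw [Nat.cast_sub (by omega)]; simp
    -- The right side is `n ^ (-4)`, which beats the cubic factor of the union bound over long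
    -- intervals.
    have h1 : Real.exp (-(p ^ 2 / 4)) ^ (B - 1) ≤ Real.exp (-(4 * lam)) := by
      rw [← Real.exp_nat_mul, Real.exp_le_exp, hB']
      have h2 : 1 / lam ≤ p ^ 2 / 4 := by
        have : 0 < 1 / lam := by positivity
        linarith
      have h3 : 4 * lam = 4 * lam ^ 2 * (1 / lam) := by field_simp
      have h4 : 4 * lam ^ 2 * (1 / lam) ≤ (B - 1) * (p ^ 2 / 4) :=
        mul_le_mul (by linarith) h2 (by positivity) (by nlinarith)
      linarith
    have hn1 : (1 : ℝ) ≤ n := by rw [hn]; exact Real.one_le_exp hlam0.le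
    calc (n : ℝ) * (n + 1) * (16 * n * Real.exp (-(p ^ 2 / 4)) ^ (B - 1))
        ≤ n * (n + n) * (16 * n * Real.exp (-(4 * lam))) := by gcongr
      _ = 32 * ((n : ℝ) ^ 3 * Real.exp (-(4 * lam))) := by ring
      _ = 32 * Real.exp (-lam) := by
          rw [hn, ← Real.exp_nat_mul, ← Real.exp_add]
          congr 2
          push_cast
          ring

lemma eventually_large_log : ∀ᶠ n : ℕ in atTop, 1 ≤ Real.log (Real.log n) ∧
    50 * Real.log (Real.log n) ^ 2 ≤ Real.log n ∧ 32 ≤ Real.log n ∧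
    4 * Real.log n ^ 2 + 2 ≤ Real.exp (Real.log n / 2) := by
  have h1 : ∀ᶠ x : ℝ in atTop, 1 ≤ Real.log x := Real.tendsto_log_atTop.eventually_ge_atTop 1
  have h2 : ∀ᶠ x : ℝ in atTop, 50 * Real.log x ^ 2 ≤ x := by
    have h := (isLittleO_log_rpow_atTop (show (0 : ℝ) < 1 / 2 by norm_num)).def
      (show (0 : ℝ) < 1 / 10 by norm_num)
    filter_upwards [h, eventually_ge_atTop 1] with x hx hx1
    have hl : 0 ≤ Real.log x := Real.log_nonneg hx1
    rw [← Real.sqrt_eq_rpow, Real.norm_of_nonneg hl, Real.norm_of_nonneg (Real.sqrt_nonneg x)] at hx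
    have hsq : Real.log x ^ 2 ≤ (1 / 10 * √x) ^ 2 := pow_le_pow_left₀ hl hx 2
    rw [mul_pow, Real.sq_sqrt (by linarith)] at hsq
    linarith
  have h3 : ∀ᶠ x : ℝ in atTop, 4 * x ^ 2 + 2 ≤ Real.exp (x / 2) := by
    filter_upwards [eventually_ge_atTop 400] with x hx
    have h := Real.pow_div_factorial_le_exp (x / 2) (by linarith) 3
    norm_num [Nat.factorial] at h
    nlinarith
  filter_upwards [tendsto_log_natCast.eventually h1, tendsto_log_natCast.eventually h2,
    tendsto_log_natCast.eventually_ge_atTop 32, tendsto_log_natCast.eventually h3] with n a b c d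
  exact ⟨a, b, c, d⟩

end TransClosure

theorem theorem2 (α : ℝ) (hα : 0 < α) :
    ∃ c C A : ℝ, 0 < c ∧ 0 < C ∧ 0 < A ∧ A < 1 ∧
      ∀ pleft pright : ℕ → unitInterval,
        ((∀ᶠ n : ℕ in Filter.atTop,
            max (pleft n : ℝ) (pright n : ℝ) < c * (1 / √(Real.log n))) →
          TransClosure.AAS pleft pright fun n =>
            {ω | ∀ e ∈ TransClosure.finalEdges ω,
              ¬ α * Real.log n < (TransClosure.edgeLength e : ℝ)}) ∧
        ((∀ᶠ n : ℕ in Filter.atTop,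
            (pleft n : ℝ) < c * (1 / √(Real.log n)) ∧ A < (pright n : ℝ)) →
          TransClosure.AAS pleft pright fun n =>
            {ω |
              (∀ e ∈ TransClosure.openEdges ω, TransClosure.IsRightward e →
                α * Real.log n < (TransClosure.edgeLength e : ℝ) →
                e ∈ TransClosure.finalEdges ω) ∧
              (∀ e ∈ TransClosure.finalEdges ω, TransClosure.IsLeftward e →
                ¬ α * Real.log n < (TransClosure.edgeLength e : ℝ))}) ∧
        ((∀ᶠ n : ℕ in Filter.atTop,
            C * (Real.log (Real.log n) / √(Real.log n)) <
              min (pleft n : ℝ) (pright n : ℝ)) →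
          TransClosure.AAS pleft pright fun n =>
            {ω | TransClosure.finalEdges ω =
              TransClosure.lineEdges n ∪ TransClosure.openEdges ω}) := by
  open TransClosure in
  have hexp : Real.exp (-(4 / α)) ≤ 1 := Real.exp_le_one_iff.2 (by
    have : 0 < 4 / α := by positivity
    linarith)
  have hexp0 : 0 < Real.exp (-(4 / α)) := Real.exp_pos _
  have hfloor : ∀ n : ℕ, 1 ≤ n → ∀ m : ℕ, α * Real.log n < m ↔ ⌊α * Real.log n⌋₊ < m := by
    intro n hn m
    rw [Nat.floor_lt]
    exact mul_nonneg hα.le (Real.log_nonneg (by exact_mod_cast hn))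
  have hinv : Tendsto (fun n : ℕ => (n : ℝ)⁻¹) atTop (𝓝 0) :=
    tendsto_inv_atTop_zero.comp tendsto_natCast_atTop_atTop
  -- The third constant makes `1 - A` equal to `s ^ 2` with `6 * s = exp (-(4 / α))`, the base of
  -- the stack estimate.
  refine ⟨lowConst α, 20, 1 - (Real.exp (-(4 / α)) / 6) ^ 2, lowConst_pos hα, by norm_num,
    by nlinarith, by nlinarith, fun pleft pright => ⟨fun h => ?_, fun h => ?_, fun h => ?_⟩⟩
  · have hlim : Tendsto (fun n : ℕ => Real.exp (4 / α) * (n : ℝ)⁻¹ + Real.exp (4 / α) * (n : ℝ)⁻¹)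
        atTop (𝓝 0) := by
      simpa using (hinv.const_mul (Real.exp (4 / α))).add (hinv.const_mul (Real.exp (4 / α)))
    refine AAS_of_compl_le hlim ?_
    filter_upwards [eventually_ge_atTop 1,
      eventually_no_long_leftward hα (pright := pright) (h.mono fun n hn =>
        (le_max_left _ _).trans_lt hn),
      eventually_no_long_rightward hα (pleft := pleft) (h.mono fun n hn =>
        (le_max_right _ _).trans_lt hn)] with n hn hL hR
    refine le_trans ?_ (add_le_add hL hR)
    rw [← integral_add .of_finite .of_finite]
    refine integral_mono_coins _ fun ω => (ind_mono fun hω => ?_).trans (ind_or_le _ _)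
    simp only [not_forall, not_not] at hω
    obtain ⟨e, he, hlen⟩ := hω
    rw [hfloor n hn] at hlen
    rcases lt_trichotomy e.1 e.2 with h' | h' | h'
    · exact Or.inr ⟨e, he, h', hlen⟩
    · obtain ⟨x, y⟩ := e
      obtain rfl : x = y := h'
      rw [edgeLength_of_le le_rfl] at hlen
      omega
    · exact Or.inl ⟨e, he, h', hlen⟩
  · have hlim : Tendsto (fun n : ℕ => 2 * Real.exp (4 / α) * (n : ℝ)⁻¹ +
        Real.exp (4 / α) * (n : ℝ)⁻¹) atTop (𝓝 0) := by
      simpa using (hinv.const_mul (2 * Real.exp (4 / α))).add (hinv.const_mul (Real.exp (4 / α)))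
    refine AAS_of_compl_le hlim ?_
    filter_upwards [eventually_ge_atTop 1,
      eventually_rightward_filled hα (pleft := pleft) (h.mono fun n hn => hn.2),
      eventually_no_long_leftward hα (pright := pright) (h.mono fun n hn => hn.1)]
      with n hn hR hL
    refine le_trans ?_ (add_le_add hR hL)
    rw [← integral_add .of_finite .of_finite]
    refine integral_mono_coins _ fun ω => (ind_mono fun hω => ?_).trans (ind_or_le _ _)
    rw [not_and_or] at hω
    rcases hω with hω | hω
    · push Not at hω
      obtain ⟨e, he, h1, h2, h3⟩ := hω
      exact Or.inl ⟨e, he, h1, (hfloor n hn _).1 h2, h3⟩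
    · push Not at hω
      obtain ⟨e, he, h1, h2⟩ := hω
      exact Or.inr ⟨e, he, h1, (hfloor n hn _).1 h2⟩
  · have hlim : Tendsto (fun n : ℕ => 4 * Real.exp (-(Real.log n / 4)) +
        32 * Real.exp (-Real.log n)) atTop (𝓝 0) := by
      have h1 : Tendsto (fun n : ℕ => Real.exp (-(Real.log n / 4))) atTop (𝓝 0) :=
        Real.tendsto_exp_neg_atTop_nhds_zero.comp
          (tendsto_log_natCast.atTop_div_const (by norm_num))
      have h2 : Tendsto (fun n : ℕ => Real.exp (-Real.log n)) atTop (𝓝 0) :=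
        Real.tendsto_exp_neg_atTop_nhds_zero.comp tendsto_log_natCast
      simpa using (h1.const_mul 4).add (h2.const_mul 32)
    refine AAS_of_compl_le hlim ?_
    filter_upwards [h, eventually_large_log] with n hp ⟨h1, h2, h3, h4⟩
    refine integral_not_saturated_le_exp _ rfl rfl rfl (fun e => ?_) ?_ h1 h2 h3 h4
    · by_cases he : e.1 < e.2
      · rw [edgeProb_of_rightward he]
        exact (hp.trans_le (min_le_right _ _)).le
      · rw [show edgeProb (pleft n) (pright n) e = pleft n from if_neg he]
        exact (hp.trans_le (min_le_left _ _)).le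
    · exact (hp.trans_le (min_le_left _ _)).le.trans (pleft n).2.2
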